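/- Let $n\ge 0$ and $z=(z_1,\dots,z_n)\in\mathbb C^n$. For distinct $r_1,\dots,r_m\in\{1,\dots,n\}$ let $\pi^{(n)}_{r_1,\dots,r_m}:\mathbb C[\mathfrak S_m]\to\mathbb C[\mathfrak S_n]$ be the embedding induced by $i\mapsto r_i$, and let $A^{(m)}=\frac1{m!}\sum_{\sigma\in\mathfrak S_m}\operatorname{sign}(\sigma)\,\sigma$; write $\sigma_{a,b}$ for the transposition of $a$ and $b$. The Gelfand–Zetlin subalgebra $\mathcal G_n\subset\mathbb C[\mathfrak S_n]$ is the unital subalgebra generated by the images under $\pi^{(n)}_{1,\dots,m}$ of the centers of $\mathbb C[\mathfrak S_m]$, $m=1,\dots,n$. The Bethe subalgebra $\mathcal B^S_n(z)$ of Gaudin type is the unital subalgebra of $\mathbb C[\mathfrak S_n]$ generated by the coefficients of the polynomials in $u$ $$\Phi_i(u)=\sum_{1\le r_1<\dots<r_i\le n} i!\,\pi^{(n)}_{r_1,\dots,r_i}(A^{(i)})\prod_{a\notin\{r_1,\dots,r_i\}}(u-z_a),\qquad i=1,\dots,n.$$ For $p\in\mathbb C$ let $\mathrm{Tr}_m:\mathbb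 C[\mathfrak S_{n+m}]\to\mathbb C[\mathfrak S_n]$ be the linear map sending $\sigma$ to $p^{c(\sigma)-c(\tau)}\tau$, where $\tau\in\mathfrak S_n$ is obtained from $\sigma$ by removing all symbols $j>n$ from its cycle notation and $c$ denotes the number of orbits (fixed points included). For $\hbar\in\mathbb C\setminus\{0\}$ the Bethe subalgebra $\mathcal B^S_{n,\hbar}(z)$ of XXX type is the unital subalgebra of $\mathbb C[\mathfrak S_n]$ generated by the coefficients $T_{m,i}$ of $u^{n-i}$, for $m=1,\dots,n-1$ and $i=1,\dots,n$, in $$T_m(u)=\mathrm{Tr}_m\Bigl(\pi^{(n+m)}_{n+1,\dots,n+m}(A^{(m)})\,\bigl(u-z_n+\hbar\textstyle\sum_{i=1}^m\sigma_{n,n+i}\bigr)\cdots\bigl(u-z_1+\hbar\sum_{i=1}^m\sigma_{1,n+i}\bigr)\Bigr).$$ Here $p$ is auxiliary; the statement below holds for every choice of $p$, which may even vary along the limit. A family of subspaces $W_t$ of $\mathbb C[\mathfrak S_n]$ tends to a subspace $W$ if it converges in the Grassmannian: eventually $\dim W_t=\dim W$, and $W_t$ has a basis that converges to a basis of $W$.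 Let $z=z(t)$ be any family of parameters (along a filter, for instance a sequence) such that $z_a\ne z_{a+1}$ eventually and $$\frac{z_{a-1}-z_a}{z_a-z_{a+1}}\to 0\qquad\text{for all }a=2,\dots,n-1.$$ Then: (1) $\mathcal B^S_n(z)$ tends to $\mathcal G_n$. (2) If in addition $\hbar=\hbar(t)$ is eventually nonzero and (when $n\ge2$) eventually $z_1\ne z_2$ and $\hbar/(z_1-z_2)\to0$, then $\mathcal B^S_{n,\hbar}(z)$ tends to $\mathcal G_n$. -/

import Mathlib

open Filter Topology Polynomial

namespace BetheSym

noncomputable section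

/-- The group algebra `ℂ[𝔖ₙ]`; `𝔖ₙ` acts on `Fin n`, the paper's `1, …, n` being `0, …, n - 1`. -/
abbrev SymAlg (n : ℕ) : Type := MonoidAlgebra ℂ (Equiv.Perm (Fin n))

/-- The embedding `ℂ[𝔖ₘ] → ℂ[𝔖ₙ]` induced by the correspondence `i ↦ r i`. -/
def embed {m n : ℕ} (r : Fin m ↪ Fin n) : SymAlg m →ₐ[ℂ] SymAlg n :=
  MonoidAlgebra.mapDomainAlgHom ℂ ℂ (Equiv.Perm.viaEmbeddingHom r)

/-- The antisymmetrizer `(1 / m!) ∑ sign(σ) σ`. -/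
def antisymmetrizer (m : ℕ) : SymAlg m :=
  ((m.factorial : ℂ)⁻¹) •
    ∑ σ : Equiv.Perm (Fin m), MonoidAlgebra.single σ (((Equiv.Perm.sign σ : ℤ) : ℂ))

/-- The transposition of `a` and `b`, as an element of the group algebra. -/
def transp {n : ℕ} (a b : Fin n) : SymAlg n :=
  MonoidAlgebra.single (Equiv.swap a b) 1

/-- The Gelfand-Zetlin subalgebra: generated by the images of the centers of `ℂ[𝔖ₘ]`,
`1 ≤ m ≤ n`, under the standard embeddings `i ↦ i`. -/
def gelfandZetlin (n : ℕ) : Subalgebra ℂ (SymAlg n) :=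
  Algebra.adjoin ℂ {x | ∃ (m : ℕ) (_ : 1 ≤ m) (h : m ≤ n),
    ∃ c ∈ Subalgebra.center ℂ (SymAlg m), x = embed (Fin.castLEEmb h) c}

/-! ### Bethe subalgebras of Gaudin type -/

open Classical in
/-- The polynomial
`Φ_i(u) = ∑_{r_1 < ⋯ < r_i} i! π_r(A) ∏_{a ∉ {r_1, …, r_i}} (u - z_a)`. -/
def gaudinPoly (n : ℕ) (z : Fin n → ℂ) (i : ℕ) : (SymAlg n)[X] :=
  ∑ r ∈ Finset.univ.filter (fun r : Fin i ↪ Fin n => StrictMono r),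
    C ((i.factorial : ℂ) • embed r (antisymmetrizer i)) *
      (∏ a : Fin n with a ∉ Set.range r, (X - C (z a))).map (algebraMap ℂ (SymAlg n))

/-- The Bethe subalgebra of Gaudin type, generated by the coefficients `Φ_{i,j}` of `u^{n-i-j}`
in `Φ_i(u)`, `1 ≤ i ≤ n`, `0 ≤ j ≤ n - i`. -/
def betheGaudin (n : ℕ) (z : Fin n → ℂ) : Subalgebra ℂ (SymAlg n) :=
  Algebra.adjoin ℂ {x | ∃ i j : ℕ, 1 ≤ i ∧ i + j ≤ n ∧ x = (gaudinPoly n z i).coeff (n - i - j)}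

/-! ### Bethe subalgebras of XXX type -/

theorem exists_return {n m : ℕ} (σ : Equiv.Perm (Fin (n + m))) (x : Fin n) :
    ∃ k : ℕ, ((σ ^ (k + 1)) (Fin.castAdd m x) : ℕ) < n := by
  refine ⟨orderOf σ - 1, ?_⟩
  rw [Nat.sub_add_cancel (orderOf_pos σ), pow_orderOf_eq_one]
  exact x.2

/-- One less than the first positive time at which `x` comes back to the first `n` symbols
under iteration of `σ`. -/
def returnTime {n m : ℕ} (σ : Equiv.Perm (Fin (n + m))) (x : Fin n) : ℕ :=
  Nat.find (exists_return σ x)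

/-- The next symbol among the first `n` symbols after `x` in its cycle in `σ`. -/
def returnMap {n m : ℕ} (σ : Equiv.Perm (Fin (n + m))) (x : Fin n) : Fin n :=
  ⟨((σ ^ (returnTime σ x + 1)) (Fin.castAdd m x) : ℕ), Nat.find_spec (exists_return σ x)⟩

theorem castAdd_returnMap {n m : ℕ} (σ : Equiv.Perm (Fin (n + m))) (x : Fin n) :
    Fin.castAdd m (returnMap σ x) = (σ ^ (returnTime σ x + 1)) (Fin.castAdd m x) := rfl

theorem returnMap_injective {n m : ℕ} (σ : Equiv.Perm (Fin (n + m))) :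
    Function.Injective (returnMap σ) := by
  have key : ∀ x y : Fin n, returnTime σ x ≤ returnTime σ y →
      returnMap σ x = returnMap σ y → x = y := by
    intro x y hle hxy
    have h := congrArg (Fin.castAdd m) hxy
    rw [castAdd_returnMap, castAdd_returnMap] at h
    obtain ⟨d, hd⟩ := Nat.exists_eq_add_of_le hle
    have e : returnTime σ y + 1 = (returnTime σ x + 1) + d := by omega
    rw [e, pow_add _ (returnTime σ x + 1) d, Equiv.Perm.mul_apply] at h
    have h' := (σ ^ (returnTime σ x + 1)).injective h
    cases d with
    | zero => simpa using h'
    | succ d =>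
      exact absurd (h' ▸ x.2 : ((σ ^ (d + 1)) (Fin.castAdd m y) : ℕ) < n)
        (Nat.find_min (exists_return σ y) (by change d < returnTime σ y; omega))
  intro x y hxy
  rcases le_total (returnTime σ x) (returnTime σ y) with h | h
  · exact key x y h hxy
  · exact (key y x h hxy.symm).symm

/-- The permutation whose cycle record is obtained from that of `σ` by removing
all symbols but the first `n`. -/
def removeSymbols {n m : ℕ} (σ : Equiv.Perm (Fin (n + m))) : Equiv.Perm (Fin n) :=
  Equiv.ofBijective (returnMap σ) (Finite.injective_iff_bijective.mp (returnMap_injective σ))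

/-- The number of orbits of `σ`, fixed points included. -/
def numOrbits {n : ℕ} (σ : Equiv.Perm (Fin n)) : ℕ :=
  Nat.card (Quotient (Equiv.Perm.SameCycle.setoid σ))

/-- The linear map `Tr_m : ℂ[𝔖ₙ₊ₘ] → ℂ[𝔖ₙ]` with parameter `p`,
`σ ↦ p ^ (c(σ) - c(τ)) τ` where `τ = removeSymbols σ`. -/
def partialTrace {n m : ℕ} (p : ℂ) (x : SymAlg (n + m)) : SymAlg n :=
  ∑ σ : Equiv.Perm (Fin (n + m)),
    MonoidAlgebra.single (removeSymbols σ)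
      (x.coeff σ * p ^ (numOrbits σ - numOrbits (removeSymbols (n := n) σ)))

/-- The polynomial `θ(A) (u - z_n + ħ ∑_i σ_{n,n+i}) ⋯ (u - z_1 + ħ ∑_i σ_{1,n+i})` with
coefficients in `ℂ[𝔖ₙ₊ₘ]`, where `θ(A)` antisymmetrizes the last `m` symbols. -/
def monodromyPoly (n m : ℕ) (ħ : ℂ) (z : Fin n → ℂ) : (SymAlg (n + m))[X] :=
  C (embed (Fin.natAddEmb n) (antisymmetrizer m)) *
    ((List.ofFn fun a : Fin n =>
      (X - C (algebraMap ℂ (SymAlg (n + m)) (z a)) +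
        C (ħ • ∑ i : Fin m, transp (Fin.castAdd m a) (Fin.natAdd n i)))).reverse).prod

/-- The coefficient `T_{m,i}(p; ħ)` of `u^{n-i}` in the transfer matrix `T_m(u; p; ħ)`, the image
of the polynomial above under `Tr_m` applied to its coefficients. -/
def transferCoeff (n : ℕ) (p ħ : ℂ) (z : Fin n → ℂ) (m i : ℕ) : SymAlg n :=
  partialTrace p ((monodromyPoly n m ħ z).coeff (n - i))

/-- The Bethe subalgebra of XXX type, generated by the `T_{m,i}(p; ħ)` with
`1 ≤ m ≤ n - 1`, `1 ≤ i ≤ n`. -/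
def betheXXX (n : ℕ) (p ħ : ℂ) (z : Fin n → ℂ) : Subalgebra ℂ (SymAlg n) :=
  Algebra.adjoin ℂ {x | ∃ m i : ℕ, 1 ≤ m ∧ m < n ∧ 1 ≤ i ∧ i ≤ n ∧ x = transferCoeff n p ħ z m i}

/-! ### Convergence of subalgebras -/

/-- Convergence of a family of subspaces of a group algebra in the Grassmannian: from some point
on the subspaces have the dimension `d` of the limit, and they have bases that converge,
coefficient by coefficient, to a basis of the limit. -/
def GrassmannTendsto {G ι : Type*} (W : ι → Submodule ℂ (MonoidAlgebra ℂ G)) (l : Filter ι)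
    (W₀ : Submodule ℂ (MonoidAlgebra ℂ G)) : Prop :=
  ∃ (d : ℕ) (b : ι → Fin d → MonoidAlgebra ℂ G) (b₀ : Fin d → MonoidAlgebra ℂ G),
    (LinearIndependent ℂ b₀ ∧ Submodule.span ℂ (Set.range b₀) = W₀) ∧
    (∀ᶠ t in l, LinearIndependent ℂ (b t) ∧ Submodule.span ℂ (Set.range (b t)) = W t) ∧
    ∀ (k : Fin d) (g : G), Tendsto (fun t => (b t k).coeff g) l (𝓝 ((b₀ k).coeff g))

/-- Convergence of subalgebras of a group algebra, as subspaces. -/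
def SubalgebraTendsto {G ι : Type*} [Group G] (B : ι → Subalgebra ℂ (MonoidAlgebra ℂ G))
    (l : Filter ι) (B₀ : Subalgebra ℂ (MonoidAlgebra ℂ G)) : Prop :=
  GrassmannTendsto (fun t => Subalgebra.toSubmodule (B t)) l (Subalgebra.toSubmodule B₀)

end

end BetheSym

/-! The limit algebra is its own centralizer, which reduces convergence to finding a few good
elements. The Gelfand–Zetlin algebra is generated by the Jucys–Murphy elements (`gelfandZetlin_eq`),
and whatever commutes with them lies in it (`mem_jucysMurphyAlg_of_commute`). Suppose algebras B_t
contain elements x_t(a) that tend to the Jucys–Murphy elements and commute with all of B_t.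
Polynomials in the x_t(a) approximate a basis of the limit and remain independent, so dim B_t is
eventually at least the limit dimension. Conversely B_t lies in the centralizer of the x_t(a), whose
dimension is upper semicontinuous, hence eventually at most that of the limit centralizer, which is
the limit itself. This squeeze is `subalgebraTendsto_of_generators`; commutativity of the whole
Bethe algebra is not needed.

Gaudin case: up to scalars, Φ_2(z_a) is the Hamiltonian Σ_b (z_a − z_{a−1})/(z_a − z_b) σ_{a,b}
(`hamiltonian_mem_betheGaudin`). Each gap is negligible against the next, so the coefficient tends
to 1 for b < a and to 0 for b > a. Commutation with every Φ_i
(`commute_hamiltonian_eval_gaudinPoly`) comes down to the fact that an antisymmetrizer on R commutes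
with the sum of the transpositions joining an outside point to R.

XXX case: T_1(z_a) equals ħ times an ordered product of the factors z_a − z_b + ħσ_{a,b}, with no
trace of p (`transfer_one_apply_site`). Divided by scalars it is 1 + ε(Gaudin Hamiltonian) + O(ε²)
with ε = ħ/(z_a − z_{a−1}) → 0, so its first-order part has the same limit. T_1 commutes with every
T_m by a fused Yang–Baxter relation and cyclicity of the partial trace (`commute_transfer`).

Self-centralization goes by induction on n. The algebra is commutative and closed under the adjoint,
hence reduced, hence spanned by idempotents e, and e ℂ[𝔖_n] e = ℂe by induction. Compression of
ℂ[𝔖_{n+1}] by such an e is averaging over 𝔖_n followed by multiplication by e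
(`compress_eq_smul_conjSum`), and averages over 𝔖_n are polynomials in the last Jucys–Murphy element
and the center of ℂ[𝔖_n] (`conjSum_perm_mem`). -/

namespace BetheSym

/-! ### Grassmannian convergence from approximate generators -/

section Convergence

variable {G ι : Type*}

theorem sum_single_coeff [Fintype G] (x : MonoidAlgebra ℂ G) :
    ∑ g, MonoidAlgebra.single g (x.coeff g) = x := by
  conv_rhs => rw [← MonoidAlgebra.sum_coeff_single x]
  rw [Finsupp.sum_fintype _ _ (by simp)]

theorem coeff_mul_eq_sum [Group G] [Fintype G] (x y : MonoidAlgebra ℂ G) (g : G) :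
    (x * y).coeff g = ∑ h, x.coeff h * y.coeff (h⁻¹ * g) := by
  conv_lhs => rw [← sum_single_coeff x, Finset.sum_mul]
  rw [MonoidAlgebra.coeff_sum, Finsupp.finsetSum_apply]
  simp only [MonoidAlgebra.coeff_single_mul_apply]

/-- Coefficientwise convergence in a group algebra. -/
def CoeffTendsto (x : ι → MonoidAlgebra ℂ G) (l : Filter ι) (x₀ : MonoidAlgebra ℂ G) : Prop :=
  ∀ g, Tendsto (fun t => (x t).coeff g) l (𝓝 (x₀.coeff g))

variable {l : Filter ι} {x y : ι → MonoidAlgebra ℂ G} {x₀ y₀ : MonoidAlgebra ℂ G}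

theorem CoeffTendsto.const (x₀ : MonoidAlgebra ℂ G) : CoeffTendsto (fun _ : ι => x₀) l x₀ :=
  fun _ => tendsto_const_nhds

theorem CoeffTendsto.add (hx : CoeffTendsto x l x₀) (hy : CoeffTendsto y l y₀) :
    CoeffTendsto (fun t => x t + y t) l (x₀ + y₀) := fun g => (hx g).add (hy g)

theorem CoeffTendsto.smul {c : ι → ℂ} {c₀ : ℂ} (hc : Tendsto c l (𝓝 c₀))
    (hx : CoeffTendsto x l x₀) : CoeffTendsto (fun t => c t • x t) l (c₀ • x₀) :=
  fun g => hc.mul (hx g)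

theorem CoeffTendsto.sum {κ : Type*} (s : Finset κ) {x : κ → ι → MonoidAlgebra ℂ G}
    {x₀ : κ → MonoidAlgebra ℂ G} (hx : ∀ k ∈ s, CoeffTendsto (x k) l (x₀ k)) :
    CoeffTendsto (fun t => ∑ k ∈ s, x k t) l (∑ k ∈ s, x₀ k) := by
  intro g
  simp only [MonoidAlgebra.coeff_sum, Finsupp.finsetSum_apply]
  exact tendsto_finsetSum _ fun k hk => hx k hk g

theorem CoeffTendsto.congr' (hx : CoeffTendsto x l x₀) (h : ∀ᶠ t in l, x t = y t) :
    CoeffTendsto y l x₀ :=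
  fun g => (hx g).congr' (h.mono fun t ht => by rw [ht])

theorem CoeffTendsto.mul [Group G] [Finite G] (hx : CoeffTendsto x l x₀)
    (hy : CoeffTendsto y l y₀) : CoeffTendsto (fun t => x t * y t) l (x₀ * y₀) := by
  have := Fintype.ofFinite G
  intro g
  simp only [coeff_mul_eq_sum]
  exact tendsto_finsetSum _ fun h _ => (hx h).mul (hy _)

/-- The coefficient functions identify a group algebra with a space of functions. -/
noncomputable def coeffEquivFun (G : Type*) [Finite G] : MonoidAlgebra ℂ G ≃ₗ[ℂ] (G → ℂ) :=
  (MonoidAlgebra.coeffLinearEquiv ℂ).trans (Finsupp.linearEquivFunOnFinite ℂ ℂ G)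

theorem eventually_linearIndependent [Finite G] {κ : Type*} [Finite κ]
    {b : ι → κ → MonoidAlgebra ℂ G} {b₀ : κ → MonoidAlgebra ℂ G}
    (hb : ∀ k, CoeffTendsto (fun t => b t k) l (b₀ k)) (h : LinearIndependent ℂ b₀) :
    ∀ᶠ t in l, LinearIndependent ℂ (b t) := by
  have := Fintype.ofFinite G
  have key : ∀ c : κ → MonoidAlgebra ℂ G,
      LinearIndependent ℂ (coeffEquivFun G ∘ c) ↔ LinearIndependent ℂ c := fun c =>
    (coeffEquivFun G).toLinearMap.linearIndependent_iff (coeffEquivFun G).ker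
  have h' := ((key b₀).2 h).eventually
  have ht : Tendsto (fun t => coeffEquivFun G ∘ b t) l (𝓝 (coeffEquivFun G ∘ b₀)) :=
    tendsto_pi_nhds.2 fun k => tendsto_pi_nhds.2 fun g => hb k g
  exact (ht.eventually h').mono fun t ht => (key _).1 ht

/-- The commutators with the members of a finite family. -/
noncomputable def commutatorMap {κ : Type*} [Group G] (x : κ → MonoidAlgebra ℂ G) :
    MonoidAlgebra ℂ G →ₗ[ℂ] (κ → MonoidAlgebra ℂ G) :=
  LinearMap.pi fun k => LinearMap.mulRight ℂ (x k) - LinearMap.mulLeft ℂ (x k)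

theorem mem_ker_commutatorMap {κ : Type*} [Group G] {x : κ → MonoidAlgebra ℂ G}
    {y : MonoidAlgebra ℂ G} : y ∈ LinearMap.ker (commutatorMap x) ↔ ∀ k, Commute y (x k) := by
  rw [LinearMap.mem_ker, funext_iff]
  exact forall_congr' fun k => sub_eq_zero

/-- The dimension of the centralizer of a finite family is upper semicontinuous. -/
theorem eventually_finrank_ker_commutatorMap_le [Group G] [Finite G] {κ : Type*} [Finite κ]
    {x : ι → κ → MonoidAlgebra ℂ G} {x₀ : κ → MonoidAlgebra ℂ G}
    (hx : ∀ k, CoeffTendsto (fun t => x t k) l (x₀ k)) :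
    ∀ᶠ t in l, Module.finrank ℂ (LinearMap.ker (commutatorMap (x t))) ≤
      Module.finrank ℂ (LinearMap.ker (commutatorMap x₀)) := by
  have := Fintype.ofFinite G
  have := Fintype.ofFinite κ
  -- On a complement of the kernel the limit commutator map is injective. Independence of the images
  -- of a basis is an open condition, so the rank cannot drop nearby.
  obtain ⟨C, hC⟩ := Submodule.exists_isCompl (LinearMap.ker (commutatorMap x₀))
  set c := Module.finBasis ℂ C
  have hli : LinearIndependent ℂ (fun j => commutatorMap x₀ (c j : MonoidAlgebra ℂ G)) := by
    have h1 : LinearIndependent ℂ (fun j => (c j : MonoidAlgebra ℂ G)) :=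
      c.linearIndependent.map' C.subtype C.ker_subtype
    refine h1.map ?_
    have : Submodule.span ℂ (Set.range fun j => (c j : MonoidAlgebra ℂ G)) ≤ C :=
      Submodule.span_le.2 (by rintro _ ⟨j, rfl⟩; exact (c j).2)
    exact hC.symm.disjoint.mono_left this
  let e : (κ → MonoidAlgebra ℂ G) ≃ₗ[ℂ] (κ → G → ℂ) :=
    LinearEquiv.piCongrRight fun _ => coeffEquivFun G
  have hli' : LinearIndependent ℂ (e ∘ fun j => commutatorMap x₀ (c j : MonoidAlgebra ℂ G)) :=
    (e.toLinearMap.linearIndependent_iff e.ker).2 hli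
  have ht : Tendsto (fun t => e ∘ fun j => commutatorMap (x t) (c j : MonoidAlgebra ℂ G)) l
      (𝓝 (e ∘ fun j => commutatorMap x₀ (c j : MonoidAlgebra ℂ G))) := by
    refine tendsto_pi_nhds.2 fun j => tendsto_pi_nhds.2 fun k => tendsto_pi_nhds.2 fun g => ?_
    have h1 := ((CoeffTendsto.const (l := l) (c j : MonoidAlgebra ℂ G)).mul (hx k)) g
    have h2 := ((hx k).mul (CoeffTendsto.const (l := l) (c j : MonoidAlgebra ℂ G))) g
    exact h1.sub h2
  refine (ht.eventually hli'.eventually).mono fun t hlt => ?_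
  have hlt' : LinearIndependent ℂ (fun j => commutatorMap (x t) (c j : MonoidAlgebra ℂ G)) :=
    (e.toLinearMap.linearIndependent_iff e.ker).1 hlt
  have hr : Module.finrank ℂ C ≤ Module.finrank ℂ (LinearMap.range (commutatorMap (x t))) := by
    have h3 : LinearIndependent ℂ (fun j => (⟨commutatorMap (x t) (c j : MonoidAlgebra ℂ G),
        LinearMap.mem_range_self _ _⟩ : LinearMap.range (commutatorMap (x t)))) :=
      LinearIndependent.of_comp (LinearMap.range (commutatorMap (x t))).subtype hlt'
    simpa using h3.fintype_card_le_finrank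
  have h4 := LinearMap.finrank_range_add_finrank_ker (commutatorMap (x t))
  have h5 := Submodule.finrank_add_eq_of_isCompl hC
  omega

/-- A family of subalgebras tends to `B₀` when it contains elements tending to generators of
`B₀` and commutes with these elements, while `B₀` is the centralizer of the generators. -/
theorem subalgebraTendsto_of_generators [Group G] [Finite G] {κ : Type*} [Finite κ]
    {B : ι → Subalgebra ℂ (MonoidAlgebra ℂ G)} {B₀ : Subalgebra ℂ (MonoidAlgebra ℂ G)}
    {x : ι → κ → MonoidAlgebra ℂ G} {x₀ : κ → MonoidAlgebra ℂ G}
    (hx : ∀ k, CoeffTendsto (fun t => x t k) l (x₀ k))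
    (hmem : ∀ᶠ t in l, ∀ k, x t k ∈ B t)
    (hcomm : ∀ᶠ t in l, ∀ y ∈ B t, ∀ k, Commute y (x t k))
    (hgen : B₀ ≤ Algebra.adjoin ℂ (Set.range x₀))
    (hcent : ∀ y, (∀ k, Commute y (x₀ k)) → y ∈ B₀) :
    SubalgebraTendsto B l B₀ := by
  have := Fintype.ofFinite G
  have approx : ∀ y₀ ∈ Algebra.adjoin ℂ (Set.range x₀), ∃ y : ι → MonoidAlgebra ℂ G,
      CoeffTendsto y l y₀ ∧ ∀ᶠ t in l, y t ∈ B t := by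
    intro y₀ hy₀
    induction hy₀ using Algebra.adjoin_induction with
    | mem y h =>
      obtain ⟨k, rfl⟩ := h
      exact ⟨fun t => x t k, hx k, hmem.mono fun t ht => ht k⟩
    | algebraMap r =>
      exact ⟨_, CoeffTendsto.const _, Eventually.of_forall fun t => (B t).algebraMap_mem r⟩
    | add a b _ _ ha hb =>
      obtain ⟨a', ha, ha'⟩ := ha
      obtain ⟨b', hb, hb'⟩ := hb
      exact ⟨_, ha.add hb, (ha'.and hb').mono fun t h => (B t).add_mem h.1 h.2⟩
    | mul a b _ _ ha hb =>
      obtain ⟨a', ha, ha'⟩ := ha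
      obtain ⟨b', hb, hb'⟩ := hb
      exact ⟨_, ha.mul hb, (ha'.and hb').mono fun t h => (B t).mul_mem h.1 h.2⟩
  set W := Subalgebra.toSubmodule B₀
  set b₀ := Module.finBasis ℂ W
  choose b hb hbB using fun k => approx (b₀ k) (hgen (b₀ k).2)
  have hli : LinearIndependent ℂ (fun k => (b₀ k : MonoidAlgebra ℂ G)) :=
    b₀.linearIndependent.map' W.subtype W.ker_subtype
  refine ⟨_, fun t k => b k t, fun k => (b₀ k : MonoidAlgebra ℂ G), ⟨hli, ?_⟩, ?_,
    fun k => hb k⟩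
  · have h := congrArg (Submodule.map W.subtype) b₀.span_eq
    rw [Submodule.map_span, Submodule.map_top, Submodule.range_subtype, ← Set.range_comp] at h
    exact h
  -- The span of the approximating basis lies in `B t`, which lies in the centralizer of `x t`,
  -- whose dimension is eventually at most that of `B₀`; so the inclusions are equalities.
  · have hker : Module.finrank ℂ (LinearMap.ker (commutatorMap x₀)) ≤ Module.finrank ℂ W :=
      Submodule.finrank_mono fun y hy => hcent y (mem_ker_commutatorMap.1 hy)
    filter_upwards [eventually_linearIndependent (b := fun t k => b k t) hb hli,
      eventually_finrank_ker_commutatorMap_le hx, hcomm, eventually_all.2 hbB] with t h1 h2 h3 h4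
    refine ⟨h1, Submodule.eq_of_le_of_finrank_le
      (Submodule.span_le.2 (by rintro _ ⟨k, rfl⟩; exact h4 k)) ?_⟩
    rw [finrank_span_eq_card h1, Fintype.card_fin]
    refine le_trans (Submodule.finrank_mono fun y hy => ?_) (h2.trans hker)
    exact mem_ker_commutatorMap.2 (h3 y hy)

end Convergence

/-! ### Permutations, transpositions and embeddings in the group algebra -/

section Basics

/-- A permutation as an element of the group algebra. -/
noncomputable abbrev perm {n : ℕ} : Equiv.Perm (Fin n) →* SymAlg n :=
  MonoidAlgebra.of ℂ (Equiv.Perm (Fin n))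

theorem transp_eq_perm {n : ℕ} (a b : Fin n) : transp a b = perm (Equiv.swap a b) := rfl

theorem transp_comm {n : ℕ} (a b : Fin n) : transp a b = transp b a := by
  rw [transp, transp, Equiv.swap_comm]

theorem single_eq_smul_perm {n : ℕ} (g : Equiv.Perm (Fin n)) (c : ℂ) :
    MonoidAlgebra.single g c = c • perm g := by simp

theorem sum_smul_perm {n : ℕ} (x : SymAlg n) : ∑ g, x.coeff g • perm g = x := by
  conv_rhs => rw [← sum_single_coeff x]
  simp

theorem perm_mul_transp {n : ℕ} (g : Equiv.Perm (Fin n)) (a b : Fin n) :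
    perm g * transp a b = transp (g a) (g b) * perm g := by
  rw [transp_eq_perm, transp_eq_perm, ← map_mul, ← map_mul, Equiv.mul_swap_eq_swap_mul]

theorem commute_perm_transp {n : ℕ} {g : Equiv.Perm (Fin n)} {a b : Fin n} (ha : g a = a)
    (hb : g b = b) : Commute (perm g) (transp a b) := by
  rw [commute_iff_eq, perm_mul_transp, ha, hb]

theorem embed_perm {m n : ℕ} (r : Fin m ↪ Fin n) (g : Equiv.Perm (Fin m)) :
    embed r (perm g) = perm (Equiv.Perm.viaEmbeddingHom r g) := by
  simp [embed]

theorem viaEmbeddingHom_swap {m n : ℕ} (r : Fin m ↪ Fin n) (a b : Fin m) :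
    Equiv.Perm.viaEmbeddingHom r (Equiv.swap a b) = Equiv.swap (r a) (r b) := by
  ext x
  rw [Equiv.Perm.viaEmbeddingHom_apply]
  by_cases hx : x ∈ Set.range r
  · obtain ⟨y, rfl⟩ := hx
    rw [Equiv.Perm.viaEmbedding_apply, ← r.injective.map_swap]
  · rw [Equiv.Perm.viaEmbedding_apply_of_notMem _ _ _ hx, Equiv.swap_apply_of_ne_of_ne]
    · rintro rfl; exact hx ⟨a, rfl⟩
    · rintro rfl; exact hx ⟨b, rfl⟩

theorem embed_transp {m n : ℕ} (r : Fin m ↪ Fin n) (a b : Fin m) :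
    embed r (transp a b) = transp (r a) (r b) := by
  rw [transp_eq_perm, embed_perm, viaEmbeddingHom_swap, transp_eq_perm]

theorem exists_viaEmbeddingHom_eq {m n : ℕ} (r : Fin m ↪ Fin n) {g : Equiv.Perm (Fin n)}
    (hg : ∀ x, x ∉ Set.range r → g x = x) : ∃ g₀, Equiv.Perm.viaEmbeddingHom r g₀ = g := by
  have h : ∀ y, ∃ y', r y' = g (r y) := by
    intro y
    by_contra hy
    have h1 : g (r y) = r y := g.injective (hg _ hy)
    exact hy ⟨y, h1.symm⟩
  choose f hf using h
  have hinj : Function.Injective f := fun y₁ y₂ h12 =>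
    r.injective (g.injective (by rw [← hf, ← hf, h12]))
  refine ⟨Equiv.ofBijective f (Finite.injective_iff_bijective.1 hinj), ?_⟩
  ext x
  rw [Equiv.Perm.viaEmbeddingHom_apply]
  by_cases hx : x ∈ Set.range r
  · obtain ⟨y, rfl⟩ := hx
    rw [Equiv.Perm.viaEmbedding_apply, Equiv.ofBijective_apply, hf]
  · rw [Equiv.Perm.viaEmbedding_apply_of_notMem _ _ _ hx, hg x hx]

end Basics

/-! ### Jucys–Murphy elements and semisimplicity of their algebra -/

section JucysMurphy

/-- The Jucys-Murphy element `∑_{b < a} σ_{b,a}`. -/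
noncomputable def jucysMurphy {n : ℕ} (a : Fin n) : SymAlg n :=
  ∑ b with b < a, transp b a

/-- Such a `g` permutes the points below `a`, so conjugation by it only permutes the summands. -/
theorem commute_perm_jucysMurphy {n : ℕ} {g : Equiv.Perm (Fin n)} {a : Fin n}
    (hg : ∀ b, a ≤ b → g b = b) : Commute (perm g) (jucysMurphy a) := by
  have hlt : ∀ b, b < a → g b < a := fun b hb => by
    by_contra h
    have := g.injective (hg _ (not_lt.1 h))
    exact h (by rw [this]; exact hb)
  have hlt' : ∀ b, g b < a → b < a := fun b hb => by
    by_contra h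
    exact h (hg b (not_lt.1 h) ▸ hb)
  rw [commute_iff_eq, jucysMurphy, Finset.mul_sum, Finset.sum_mul]
  refine Finset.sum_bij (fun b _ => g b) (by simpa using hlt) (fun _ _ _ _ h => g.injective h)
    (fun b hb => ⟨g⁻¹ b, ?_, by simp⟩) (fun b _ => by rw [perm_mul_transp, hg a le_rfl])
  simp only [Finset.mem_filter, Finset.mem_univ, true_and] at hb ⊢
  exact hlt' _ (by simpa using hb)

theorem commute_jucysMurphy {n : ℕ} (a b : Fin n) :
    Commute (jucysMurphy a) (jucysMurphy b) := by
  have key : ∀ a b : Fin n, a < b → Commute (jucysMurphy a) (jucysMurphy b) := by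
    intro a b hab
    refine Commute.sum_left _ _ _ fun c hc => commute_perm_jucysMurphy fun d hd => ?_
    have hc : c < a := by simpa using hc
    exact Equiv.swap_apply_of_ne_of_ne ((hc.trans hab).trans_le hd).ne' (hab.trans_le hd).ne'
  rcases lt_trichotomy a b with h | h | h
  · exact key a b h
  · rw [h]
  · exact (key b a h).symm

/-- The subalgebra generated by the Jucys-Murphy elements. -/
noncomputable def jucysMurphyAlg (n : ℕ) : Subalgebra ℂ (SymAlg n) :=
  Algebra.adjoin ℂ (Set.range jucysMurphy)

theorem jucysMurphy_mem {n : ℕ} (a : Fin n) : jucysMurphy a ∈ jucysMurphyAlg n :=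
  Algebra.subset_adjoin ⟨a, rfl⟩

theorem commute_of_commute_jucysMurphy {n : ℕ} {y : SymAlg n}
    (hy : ∀ a, Commute y (jucysMurphy a)) {x : SymAlg n} (hx : x ∈ jucysMurphyAlg n) :
    Commute y x := by
  induction hx using Algebra.adjoin_induction with
  | mem x h => obtain ⟨a, rfl⟩ := h; exact hy a
  | algebraMap r => exact (Algebra.commutes r y).symm
  | add a b _ _ ha hb => exact ha.add_right hb
  | mul a b _ _ ha hb => exact ha.mul_right hb

theorem commute_of_mem_jucysMurphyAlg {n : ℕ} {x y : SymAlg n} (hx : x ∈ jucysMurphyAlg n)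
    (hy : y ∈ jucysMurphyAlg n) : Commute x y :=
  commute_of_commute_jucysMurphy (fun a =>
    (commute_of_commute_jucysMurphy (fun b => commute_jucysMurphy a b) hx).symm) hy

/-- The adjoint `∑ c_g g ↦ ∑ conj(c_g) g⁻¹`. -/
noncomputable def adjoint {n : ℕ} (x : SymAlg n) : SymAlg n :=
  ∑ g, MonoidAlgebra.single g⁻¹ (starRingEnd ℂ (x.coeff g))

theorem coeff_adjoint {n : ℕ} (x : SymAlg n) (g : Equiv.Perm (Fin n)) :
    (adjoint x).coeff g = starRingEnd ℂ (x.coeff g⁻¹) := by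
  rw [adjoint, MonoidAlgebra.coeff_sum, Finsupp.finsetSum_apply, Finset.sum_eq_single g⁻¹]
  · simp
  · intro h _ hh
    rw [MonoidAlgebra.coeff_single, Finsupp.single_eq_of_ne]
    rintro rfl
    exact hh (inv_inv h).symm
  · simp

theorem adjoint_add {n : ℕ} (x y : SymAlg n) : adjoint (x + y) = adjoint x + adjoint y := by
  ext g
  simp [coeff_adjoint]

theorem adjoint_mul {n : ℕ} (x y : SymAlg n) : adjoint (x * y) = adjoint y * adjoint x := by
  ext g
  rw [coeff_adjoint, coeff_mul_eq_sum, coeff_mul_eq_sum, map_sum]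
  refine Fintype.sum_equiv (Equiv.mulLeft g) _ _ fun h => ?_
  simp only [coeff_adjoint, map_mul, Equiv.coe_mulLeft, mul_inv_rev, inv_inv]
  rw [mul_comm, inv_mul_cancel_left]

theorem adjoint_perm {n : ℕ} (g : Equiv.Perm (Fin n)) : adjoint (perm g) = perm g⁻¹ := by
  ext h
  rw [coeff_adjoint]
  simp only [MonoidAlgebra.of_apply, MonoidAlgebra.coeff_single, Finsupp.single_apply,
    inv_eq_iff_eq_inv, apply_ite (starRingEnd ℂ), map_one, map_zero]

theorem adjoint_algebraMap {n : ℕ} (c : ℂ) :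
    adjoint (algebraMap ℂ (SymAlg n) c) = algebraMap ℂ (SymAlg n) (starRingEnd ℂ c) := by
  ext h
  rw [coeff_adjoint]
  simp only [MonoidAlgebra.coe_algebraMap, Function.comp_apply, MonoidAlgebra.coeff_single,
    Finsupp.single_apply, apply_ite (starRingEnd ℂ), map_zero, inv_eq_one, eq_comm (a := (1 : Equiv.Perm (Fin n)))]
  rfl

theorem adjoint_sum {n : ℕ} {κ : Type*} (s : Finset κ) (x : κ → SymAlg n) :
    adjoint (∑ k ∈ s, x k) = ∑ k ∈ s, adjoint (x k) := by
  ext g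
  simp [coeff_adjoint, Finsupp.finsetSum_apply]

theorem adjoint_jucysMurphy {n : ℕ} (a : Fin n) : adjoint (jucysMurphy a) = jucysMurphy a := by
  rw [jucysMurphy, adjoint_sum]
  refine Finset.sum_congr rfl fun b _ => ?_
  rw [transp_eq_perm, adjoint_perm, Equiv.swap_inv]

theorem adjoint_mem_jucysMurphyAlg {n : ℕ} {x : SymAlg n} (hx : x ∈ jucysMurphyAlg n) :
    adjoint x ∈ jucysMurphyAlg n := by
  induction hx using Algebra.adjoin_induction with
  | mem x h => obtain ⟨a, rfl⟩ := h; rw [adjoint_jucysMurphy]; exact jucysMurphy_mem a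
  | algebraMap r => rw [adjoint_algebraMap]; exact Subalgebra.algebraMap_mem _ _
  | add a b _ _ ha hb => rw [adjoint_add]; exact add_mem ha hb
  | mul a b _ _ ha hb => rw [adjoint_mul]; exact mul_mem hb ha

/-- The coefficient of the identity in x*x is Σ |x_g|². -/
theorem eq_zero_of_adjoint_mul_self {n : ℕ} {x : SymAlg n} (h : adjoint x * x = 0) : x = 0 := by
  have h1 : (adjoint x * x).coeff 1 = 0 := by rw [h]; rfl
  rw [coeff_mul_eq_sum] at h1
  have h2 : ∀ g, (adjoint x).coeff g * x.coeff (g⁻¹ * 1) =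
      ((Complex.normSq (x.coeff g⁻¹) : ℝ) : ℂ) := fun g => by
    rw [coeff_adjoint, mul_one, mul_comm, Complex.mul_conj]
  simp only [h2] at h1
  rw [← Complex.ofReal_sum, Complex.ofReal_eq_zero,
    Finset.sum_eq_zero_iff_of_nonneg (fun _ _ => Complex.normSq_nonneg _)] at h1
  ext g
  simpa using h1 g⁻¹ (Finset.mem_univ _)

/-- Every element commutes with its adjoint, and positivity, applied first to x*x and then to x,
shows that a normal element of square zero vanishes. -/
theorem isReduced_jucysMurphyAlg (n : ℕ) : IsReduced (jucysMurphyAlg n) := by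
  rw [isReduced_iff_pow_one_lt 2 one_lt_two]
  rintro ⟨x, hx⟩ h
  have hxx : x * x = 0 := by simpa [pow_two] using congrArg Subtype.val h
  have hc := commute_of_mem_jucysMurphyAlg hx (adjoint_mem_jucysMurphyAlg hx)
  refine Subtype.ext (eq_zero_of_adjoint_mul_self (eq_zero_of_adjoint_mul_self ?_))
  have h3 : adjoint (adjoint x) = x := by ext g; simp [coeff_adjoint]
  change adjoint (adjoint x * x) * (adjoint x * x) = 0
  rw [adjoint_mul, h3, mul_assoc, ← mul_assoc x, hc.eq, mul_assoc (adjoint x) x x, hxx, mul_zero,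
    mul_zero]

/-- A reduced finite-dimensional commutative algebra over `ℂ` is spanned by idempotents. -/
theorem exists_idempotents (R : Type) [CommRing R] [Algebra ℂ R] [Module.Finite ℂ R]
    [IsReduced R] : ∃ (κ : Type) (_ : Fintype κ) (e : κ → R), ∑ k, e k = 1 ∧
      ∀ k, e k * e k = e k ∧ ∀ x, ∃ c : ℂ, e k * x = c • e k := by
  classical
  have : IsArtinianRing R := IsArtinianRing.of_finite ℂ R
  have := Fintype.ofFinite (MaximalSpectrum R)
  -- A reduced Artinian ring is the product of its residue fields; each is finite over ℂ, hence ℂ,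
  -- and the idempotents are the unit vectors.
  let f := IsArtinianRing.equivPi R
  refine ⟨MaximalSpectrum R, inferInstance, fun k => f.symm (Pi.single k 1), ?_, fun k => ⟨?_, ?_⟩⟩
  · rw [← map_sum, Finset.univ_sum_single (fun k : MaximalSpectrum R => (1 : R ⧸ k.asIdeal))]
    exact map_one f.symm
  · rw [← map_mul, ← Pi.single_mul, mul_one]
  · intro x
    have := k.isMaximal
    have hint : Algebra.IsIntegral ℂ (R ⧸ k.asIdeal) := inferInstance
    obtain ⟨c, hc⟩ := (IsAlgClosed.algebraMap_bijective_of_isIntegral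
      (k := ℂ) (K := R ⧸ k.asIdeal)).2 (f x k)
    refine ⟨c, f.injective ?_⟩
    rw [Algebra.smul_def, map_mul, map_mul, f.apply_symm_apply]
    ext j
    by_cases hj : j = k
    · subst hj
      simp only [Pi.mul_apply, Pi.single_eq_same, one_mul, mul_one]
      rw [← hc]
      rfl
    · simp [Pi.single_eq_of_ne hj]

end JucysMurphy

/-! ### Maximal commutativity and the Gelfand–Zetlin algebra -/

section Centralizer

/-- The standard embedding `𝔖ₙ → 𝔖ₙ₊₁`. -/
noncomputable abbrev liftPerm {n : ℕ} : Equiv.Perm (Fin n) →* Equiv.Perm (Fin (n + 1)) :=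
  Equiv.Perm.viaEmbeddingHom (Fin.castLEEmb n.le_succ)

theorem liftPerm_last {n : ℕ} (g : Equiv.Perm (Fin n)) : liftPerm g (Fin.last n) = Fin.last n := by
  refine Equiv.Perm.viaEmbedding_apply_of_notMem _ _ _ ?_
  rintro ⟨y, hy⟩
  have := congrArg Fin.val hy
  simp at this
  omega

theorem exists_liftPerm_eq {n : ℕ} {g : Equiv.Perm (Fin (n + 1))} (hg : g (Fin.last n) = Fin.last n) :
    ∃ g₀, liftPerm g₀ = g := by
  refine exists_viaEmbeddingHom_eq _ fun x hx => ?_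
  rcases Fin.eq_castSucc_or_eq_last x with ⟨y, rfl⟩ | rfl
  · exact absurd ⟨y, rfl⟩ hx
  · exact hg

/-- The sum of the conjugates of `x` under the standard copy of `𝔖ₙ` in `𝔖ₙ₊₁`. -/
noncomputable def conjSum {n : ℕ} : SymAlg (n + 1) →ₗ[ℂ] SymAlg (n + 1) :=
  ∑ h : Equiv.Perm (Fin n), LinearMap.mulLeft ℂ (perm (liftPerm h)) ∘ₗ
    LinearMap.mulRight ℂ (perm (liftPerm h⁻¹))

theorem conjSum_apply {n : ℕ} (x : SymAlg (n + 1)) :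
    conjSum x = ∑ h : Equiv.Perm (Fin n), perm (liftPerm h) * (x * perm (liftPerm h⁻¹)) := by
  simp [conjSum, LinearMap.sum_apply]

theorem conjSum_conj {n : ℕ} (k : Equiv.Perm (Fin n)) (x : SymAlg (n + 1)) :
    conjSum (perm (liftPerm k) * x * perm (liftPerm k⁻¹)) = conjSum x := by
  rw [conjSum_apply, conjSum_apply]
  refine Fintype.sum_equiv (Equiv.mulRight k) _ _ fun h => ?_
  simp only [Equiv.coe_mulRight, mul_inv_rev, map_mul, mul_assoc]

/-- For a permutation from 𝔖_n the sum of conjugates is already central in ℂ[𝔖_n], so the hypothesis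
on the center applies. -/
theorem conjSum_embed_mem {n : ℕ}
    (hc : ∀ c ∈ Subalgebra.center ℂ (SymAlg n), c ∈ jucysMurphyAlg n) (g : Equiv.Perm (Fin n)) :
    conjSum (perm (liftPerm g)) ∈ (jucysMurphyAlg n).map (embed (Fin.castLEEmb n.le_succ)) := by
  refine ⟨∑ h : Equiv.Perm (Fin n), perm (h * (g * h⁻¹)), hc _ ?_, ?_⟩
  · rw [Subalgebra.mem_center_iff]
    intro b
    rw [← sum_smul_perm b, Finset.sum_mul, Finset.mul_sum]
    refine Finset.sum_congr rfl fun k _ => ?_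
    rw [smul_mul_assoc, mul_smul_comm, Finset.mul_sum, Finset.sum_mul]
    congr 1
    refine Fintype.sum_equiv (Equiv.mulLeft k) _ _ fun h => ?_
    rw [← map_mul, ← map_mul]
    congr 1
    simp only [Equiv.coe_mulLeft]
    group
  · change embed _ _ = _
    rw [map_sum, conjSum_apply]
    refine Finset.sum_congr rfl fun h _ => ?_
    rw [embed_perm, map_mul, map_mul, map_mul, map_mul]

theorem embed_jucysMurphy {m n : ℕ} (h : m ≤ n) (a : Fin m) :
    embed (Fin.castLEEmb h) (jucysMurphy a) = jucysMurphy (Fin.castLE h a) := by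
  rw [jucysMurphy, map_sum, jucysMurphy]
  refine Finset.sum_bij (fun b _ => Fin.castLE h b) (fun b hb => ?_)
    (fun _ _ _ _ e => Fin.castLE_injective h e) (fun b hb => ?_) (fun b _ => embed_transp _ _ _)
  · have hb : b < a := by simpa using hb
    exact Finset.mem_filter.2 ⟨Finset.mem_univ _, hb⟩
  have hb : b < Fin.castLE h a := (Finset.mem_filter.1 hb).2
  have hb' : (b : ℕ) < a := hb
  exact ⟨⟨b, by omega⟩, Finset.mem_filter.2 ⟨Finset.mem_univ _, hb'⟩, rfl⟩

theorem map_embed_jucysMurphyAlg_le {m n : ℕ} (h : m ≤ n) :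
    (jucysMurphyAlg m).map (embed (Fin.castLEEmb h)) ≤ jucysMurphyAlg n := by
  rw [jucysMurphyAlg, AlgHom.map_adjoin]
  refine Algebra.adjoin_le ?_
  rintro _ ⟨_, ⟨a, rfl⟩, rfl⟩
  rw [embed_jucysMurphy]
  exact jucysMurphy_mem _

theorem jucysMurphy_last {n : ℕ} :
    jucysMurphy (Fin.last n) = ∑ c with c ≠ Fin.last n, transp c (Fin.last n) := by
  rw [jucysMurphy]
  refine Finset.sum_congr ?_ fun _ _ => rfl
  ext c
  simp [Fin.lt_last_iff_ne_last]

theorem jucysMurphy_last_mul_conjSum {n : ℕ} (x : SymAlg (n + 1)) :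
    jucysMurphy (Fin.last n) * conjSum x = conjSum (jucysMurphy (Fin.last n) * x) := by
  rw [conjSum_apply, conjSum_apply, Finset.mul_sum]
  refine Finset.sum_congr rfl fun h _ => ?_
  have : Commute (perm (liftPerm h)) (jucysMurphy (Fin.last n)) :=
    commute_perm_jucysMurphy fun b hb => by
      rw [Fin.last_le_iff.1 hb, liftPerm_last]
  rw [← mul_assoc, ← this.eq, mul_assoc, mul_assoc]

/-- Induction on the number of moved points other than the last symbol z. If g moves z, put b = g⁻¹z
and g' = (b z)g, which moves fewer such points. Multiplying the average of g' by the last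
Jucys–Murphy element gives the averages of all (c z)g'. Those with c fixed by g' equal the average
of g, and c = b occurs among them; the others fall under the induction hypothesis. Dividing by the
number of fixed c recovers the average of g. -/
theorem conjSum_perm_mem {n : ℕ}
    (hc : ∀ c ∈ Subalgebra.center ℂ (SymAlg n), c ∈ jucysMurphyAlg n)
    (g : Equiv.Perm (Fin (n + 1))) : conjSum (perm g) ∈ jucysMurphyAlg (n + 1) := by
  induction hk : (Finset.univ.filter fun x => x ≠ Fin.last n ∧ g x ≠ x).card
    using Nat.strong_induction_on generalizing g with
  | _ k ih =>
    by_cases hg : g (Fin.last n) = Fin.last n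
    · obtain ⟨g₀, rfl⟩ := exists_liftPerm_eq hg
      exact map_embed_jucysMurphyAlg_le _ (conjSum_embed_mem hc g₀)
    set z := Fin.last n
    set b := g⁻¹ z with hb
    have hgb : g b = z := by simp [hb]
    have hbz : b ≠ z := fun h => hg (h ▸ hgb)
    set g' := Equiv.swap b z * g with hg'
    have hg'b : g' b = b := by rw [hg', Equiv.Perm.mul_apply, hgb, Equiv.swap_apply_right]
    have hfix : ∀ x, x ≠ z → g x = x → g' x = x := by
      intro x hx hgx
      rw [hg', Equiv.Perm.mul_apply, hgx, Equiv.swap_apply_of_ne_of_ne _ hx]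
      rintro rfl
      exact hbz (hgx.symm.trans hgb)
    have hsub : (Finset.univ.filter fun x => x ≠ z ∧ g' x ≠ x) ⊂
        Finset.univ.filter fun x => x ≠ z ∧ g x ≠ x := by
      refine Finset.ssubset_iff_subset_ne.2 ⟨fun x => ?_, fun h => ?_⟩
      · simp only [Finset.mem_filter, Finset.mem_univ, true_and]
        exact fun hx => ⟨hx.1, fun h => hx.2 (hfix x hx.1 h)⟩
      · have : b ∈ Finset.univ.filter fun x => x ≠ z ∧ g x ≠ x := by
          simp [hbz, hgb, hbz.symm]
        rw [← h] at this
        simp [hg'b] at this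
    have hlt := Finset.card_lt_card hsub
    have hsum : jucysMurphy z * conjSum (perm g') =
        ∑ c with c ≠ z, conjSum (perm (Equiv.swap c z * g')) := by
      rw [jucysMurphy_last_mul_conjSum, jucysMurphy_last, Finset.sum_mul, map_sum]
      refine Finset.sum_congr rfl fun c _ => ?_
      rw [transp_eq_perm, ← perm.map_mul]
    rw [← Finset.sum_filter_add_sum_filter_not _ (fun c => g' c = c)] at hsum
    -- Both b and c are fixed by g', so (c b), which lies in 𝔖_n, commutes with g' and conjugates (c
    -- z)g' to (b z)g' = g.
    have h1 : ∀ c ∈ (Finset.univ.filter fun c => c ≠ z).filter fun c => g' c = c,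
        conjSum (perm (Equiv.swap c z * g')) = conjSum (perm g) := by
      intro c hc
      simp only [Finset.mem_filter, Finset.mem_univ, true_and] at hc
      obtain ⟨hcz, hgc⟩ := hc
      obtain ⟨s, hs⟩ := exists_liftPerm_eq (g := Equiv.swap c b)
        (Equiv.swap_apply_of_ne_of_ne hcz.symm hbz.symm)
      have hcomm : g' * Equiv.swap c b = Equiv.swap c b * g' := by
        rw [Equiv.mul_swap_eq_swap_mul, hgc, hg'b]
      have hgg : g = Equiv.swap b z * g' := by rw [hg', Equiv.swap_mul_self_mul]
      have hconj : g = Equiv.swap c b * (Equiv.swap c z * g') * (Equiv.swap c b)⁻¹ := by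
        have hzz : Equiv.swap c b * Equiv.swap c z = Equiv.swap b z * Equiv.swap c b := by
          rw [Equiv.mul_swap_eq_swap_mul, Equiv.swap_apply_left,
            Equiv.swap_apply_of_ne_of_ne hcz.symm hbz.symm]
        rw [Equiv.swap_inv, ← mul_assoc, hzz, mul_assoc, mul_assoc, hcomm, Equiv.swap_mul_self_mul]
        exact hgg
      conv_rhs => rw [hconj, ← hs, ← map_inv, perm.map_mul, perm.map_mul]
      rw [conjSum_conj]
    rw [Finset.sum_congr rfl h1, Finset.sum_const] at hsum
    set N := ((Finset.univ.filter fun c => c ≠ z).filter fun c => g' c = c).card with hN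
    have hN0 : N ≠ 0 := by
      refine Finset.card_ne_zero_of_mem (a := b) ?_
      simp [hbz, hg'b]
    have hlow : ∑ c ∈ (Finset.univ.filter fun c => c ≠ z).filter fun c => ¬ g' c = c,
        conjSum (perm (Equiv.swap c z * g')) ∈ jucysMurphyAlg (n + 1) := by
      refine sum_mem fun c hc => ?_
      simp only [Finset.mem_filter, Finset.mem_univ, true_and] at hc
      obtain ⟨hcz, hgc⟩ := hc
      refine ih _ ?_ _ rfl
      rw [← hk]
      refine lt_of_le_of_lt (Finset.card_le_card fun x => ?_) hlt
      simp only [Finset.mem_filter, Finset.mem_univ, true_and]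
      refine fun hx => ⟨hx.1, fun h => hx.2 ?_⟩
      rw [Equiv.Perm.mul_apply, h, Equiv.swap_apply_of_ne_of_ne _ hx.1]
      rintro rfl
      exact hgc h
    have hfin : conjSum (perm g) = (N : ℂ)⁻¹ • (jucysMurphy z * conjSum (perm g') -
        ∑ c ∈ (Finset.univ.filter fun c => c ≠ z).filter fun c => ¬ g' c = c,
          conjSum (perm (Equiv.swap c z * g'))) := by
      rw [hsum, add_sub_cancel_right, ← Nat.cast_smul_eq_nsmul ℂ, smul_smul,
        inv_mul_cancel₀ (Nat.cast_ne_zero.2 hN0), one_smul]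
    rw [hfin]
    refine Subalgebra.smul_mem _ (sub_mem (mul_mem (jucysMurphy_mem _) ?_) hlow) _
    exact ih _ (hk ▸ hlt) _ rfl

theorem conjSum_mem {n : ℕ}
    (hc : ∀ c ∈ Subalgebra.center ℂ (SymAlg n), c ∈ jucysMurphyAlg n)
    (y : SymAlg (n + 1)) : conjSum y ∈ jucysMurphyAlg (n + 1) := by
  rw [← sum_smul_perm y, map_sum]
  refine sum_mem fun g _ => ?_
  rw [map_smul]
  exact Subalgebra.smul_mem _ (conjSum_perm_mem hc g) _

/-- If `e` is an idempotent with `e ℂ[𝔖ₙ] e ⊆ ℂ e`, then compression by `e` is, up to a factor,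
averaging over `𝔖ₙ` followed by multiplication by `e`. -/
theorem compress_eq_smul_conjSum {n : ℕ} {e : SymAlg n} (he : e * e = e)
    (hprim : ∀ x, ∃ c : ℂ, e * x * e = c • e) (y : SymAlg (n + 1)) :
    embed (Fin.castLEEmb n.le_succ) e * y * embed (Fin.castLEEmb n.le_succ) e =
      e.coeff 1 • (embed (Fin.castLEEmb n.le_succ) e *
        conjSum (embed (Fin.castLEEmb n.le_succ) e * y)) := by
  choose χ hχ using fun h => hprim (perm h)
  -- The coefficient at 1 is a trace: taken on e h e = χ(h) e, it gives that of h e, which is the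
  -- coefficient of e at h⁻¹.
  have hcoeff : ∀ h, χ h * e.coeff 1 = e.coeff h⁻¹ := by
    intro h
    have h1 := congrArg (fun x => x.coeff 1) (hχ h)
    simp only [MonoidAlgebra.coeff_smul, Finsupp.smul_apply, smul_eq_mul] at h1
    rw [← h1, coeff_mul_eq_sum]
    have h2 : e.coeff h⁻¹ = (perm h * (e * e)).coeff 1 := by
      rw [he, MonoidAlgebra.of_apply, MonoidAlgebra.coeff_single_mul_apply, one_mul, mul_one]
    rw [h2, ← mul_assoc, coeff_mul_eq_sum]
    have h3 : ∀ a b : SymAlg n, (a * b).coeff 1 = (b * a).coeff 1 := by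
      intro a b
      rw [coeff_mul_eq_sum, coeff_mul_eq_sum]
      refine Fintype.sum_equiv (Equiv.inv _) _ _ fun k => ?_
      simp [mul_comm]
    rw [← coeff_mul_eq_sum, ← coeff_mul_eq_sum, mul_assoc, h3, mul_assoc, he]
  set E := embed (Fin.castLEEmb n.le_succ) e with hE
  have hterm : ∀ h : Equiv.Perm (Fin n),
      e.coeff 1 • (E * (perm (liftPerm h) * (E * y * perm (liftPerm h⁻¹)))) =
        e.coeff h⁻¹ • (E * y * perm (liftPerm h⁻¹)) := by
    intro h
    have h1 : E * perm (liftPerm h) * E = χ h • E := by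
      rw [hE, ← embed_perm, ← map_mul, ← map_mul, hχ, map_smul]
    rw [← mul_assoc, ← mul_assoc, ← mul_assoc, h1, smul_mul_assoc, smul_mul_assoc, smul_smul,
      mul_comm, hcoeff]
  -- By `hterm` the average becomes Σ e_{h⁻¹} E y h⁻¹, which reassembles to E y E.
  rw [conjSum_apply, Finset.mul_sum, Finset.smul_sum, Finset.sum_congr rfl fun h _ => hterm h]
  have h5 : E = ∑ h : Equiv.Perm (Fin n), e.coeff h⁻¹ • perm (liftPerm h⁻¹) := by
    conv_lhs => rw [hE, ← sum_smul_perm e, map_sum]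
    refine Fintype.sum_equiv (Equiv.inv _) _ _ fun h => ?_
    simp only [map_smul, embed_perm, Equiv.inv_apply, inv_inv]
  conv_lhs => rw [h5, Finset.mul_sum]
  refine Finset.sum_congr rfl fun h _ => ?_
  rw [mul_smul_comm, ← h5]

/-- The Jucys-Murphy elements generate a maximal commutative subalgebra. -/
theorem mem_jucysMurphyAlg_of_commute {n : ℕ} {y : SymAlg n}
    (hy : ∀ a, Commute y (jucysMurphy a)) : y ∈ jucysMurphyAlg n := by
  induction n with
  | zero =>
    rw [← sum_smul_perm y]
    refine sum_mem fun g _ => Subalgebra.smul_mem _ ?_ _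
    rw [Subsingleton.elim g 1, map_one]
    exact one_mem _
  | succ n ih =>
    have hc : ∀ c ∈ Subalgebra.center ℂ (SymAlg n), c ∈ jucysMurphyAlg n := fun c hc =>
      ih fun a => ((Subalgebra.mem_center_iff.1 hc) _).symm
    have := isReduced_jucysMurphyAlg n
    let _ : CommRing (jucysMurphyAlg n) :=
      { (inferInstance : Ring (jucysMurphyAlg n)) with
        mul_comm := fun a b => Subtype.ext (commute_of_mem_jucysMurphyAlg a.2 b.2) }
    obtain ⟨κ, _, e, he1, he⟩ := exists_idempotents (jucysMurphyAlg n)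
    have hmem : ∀ k, embed (Fin.castLEEmb n.le_succ) (e k : SymAlg n) ∈ jucysMurphyAlg (n + 1) :=
      fun k => map_embed_jucysMurphyAlg_le _ ⟨_, (e k).2, rfl⟩
    have hidem : ∀ k, (e k : SymAlg n) * e k = e k := fun k => congrArg Subtype.val (he k).1
    -- Commuting with the idempotents, y is block diagonal; each block is then a compression.
    have hyk : y = ∑ k, embed (Fin.castLEEmb n.le_succ) (e k : SymAlg n) * y *
        embed (Fin.castLEEmb n.le_succ) (e k : SymAlg n) := by
      have h1 : ∑ k, embed (Fin.castLEEmb n.le_succ) (e k : SymAlg n) = 1 := by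
        rw [← map_sum]
        have := congrArg (Subtype.val) he1
        rw [AddSubmonoidClass.coe_finsetSum] at this
        rw [this]
        exact map_one _
      conv_lhs => rw [← mul_one y, ← h1, Finset.mul_sum]
      refine Finset.sum_congr rfl fun k _ => ?_
      rw [← (commute_of_commute_jucysMurphy hy (hmem k)).eq, mul_assoc, ← map_mul, hidem]
    rw [hyk]
    refine sum_mem fun k _ => ?_
    rw [compress_eq_smul_conjSum (hidem k)]
    · exact Subalgebra.smul_mem _ (mul_mem (hmem k) (conjSum_mem hc _)) _
    · intro x
      -- Every Jucys–Murphy element acts on e_k by a scalar from either side, so e_k x e_k commutes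
      -- with all of them and the induction hypothesis applies.
      have hx : (e k : SymAlg n) * x * e k ∈ jucysMurphyAlg n := by
        refine ih fun a => ?_
        obtain ⟨c, hc⟩ := (he k).2 ⟨_, jucysMurphy_mem a⟩
        have hc : (e k : SymAlg n) * jucysMurphy a = c • (e k : SymAlg n) :=
          congrArg Subtype.val hc
        have hc' := commute_of_mem_jucysMurphyAlg (e k).2 (jucysMurphy_mem a)
        rw [commute_iff_eq, mul_assoc, hc, ← mul_assoc, ← mul_assoc, ← hc'.eq, hc]
        simp only [mul_smul_comm, smul_mul_assoc]
      obtain ⟨c, hc⟩ := (he k).2 ⟨_, hx⟩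
      refine ⟨c, ?_⟩
      have hc : (e k : SymAlg n) * (e k * x * e k) = c • (e k : SymAlg n) :=
        congrArg Subtype.val hc
      rw [← hc, ← mul_assoc, ← mul_assoc, hidem]

/-- The sum of `transp b a` over all ordered pairs is visibly invariant under conjugation; it counts
each transposition twice and adds the identity once for each diagonal pair. -/
theorem sum_jucysMurphy_mem_center (n : ℕ) :
    ∑ a : Fin n, jucysMurphy a ∈ Subalgebra.center ℂ (SymAlg n) := by
  have hall : ∀ g : Equiv.Perm (Fin n),
      perm g * ∑ a : Fin n, ∑ b : Fin n, transp b a =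
        (∑ a : Fin n, ∑ b : Fin n, transp b a) * perm g := by
    intro g
    simp only [Finset.mul_sum, Finset.sum_mul]
    refine Fintype.sum_equiv g _ _ fun a => Fintype.sum_equiv g _ _ fun b => ?_
    rw [perm_mul_transp]
  have hsplit : ∑ a : Fin n, ∑ b : Fin n, transp b a =
      (2 : ℂ) • (∑ a : Fin n, jucysMurphy a) + (n : ℂ) • (1 : SymAlg n) := by
    have h1 : ∀ a b : Fin n, transp b a = (if b < a then transp b a else 0) +
        ((if a < b then transp a b else 0) + if b = a then (1 : SymAlg n) else 0) := by
      intro a b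
      rcases lt_trichotomy a b with h | h | h
      · simp [h, h.not_gt, h.ne', transp_comm b a]
      · subst h
        rw [transp_eq_perm, Equiv.swap_self, ← Equiv.Perm.one_def, map_one]
        simp
      · simp [h, h.not_gt, h.ne]
    rw [Finset.sum_congr rfl fun a _ => Finset.sum_congr rfl fun b _ => h1 a b]
    simp only [Finset.sum_add_distrib]
    rw [Finset.sum_comm (f := fun a b => if a < b then transp a b else 0), ← add_assoc, two_smul]
    simp only [jucysMurphy, Finset.sum_filter]
    congr 1
    simp [Nat.cast_smul_eq_nsmul]
  have h2 : ∑ a : Fin n, jucysMurphy a =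
      (2 : ℂ)⁻¹ • (∑ a : Fin n, ∑ b : Fin n, transp b a - (n : ℂ) • (1 : SymAlg n)) := by
    rw [hsplit, add_sub_cancel_right, smul_smul, inv_mul_cancel₀ two_ne_zero, one_smul]
  rw [h2]
  refine Subalgebra.smul_mem _ (sub_mem ?_ (Subalgebra.smul_mem _ (one_mem _) _)) _
  rw [Subalgebra.mem_center_iff]
  intro y
  rw [← sum_smul_perm y, Finset.sum_mul, Finset.mul_sum]
  refine Finset.sum_congr rfl fun g _ => ?_
  rw [smul_mul_assoc, hall, mul_smul_comm]

/-- Maximal commutativity for each m puts the centers inside the Jucys–Murphy algebra. Conversely a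
Jucys–Murphy element is the difference of two consecutive central sums. -/
theorem gelfandZetlin_eq (n : ℕ) : gelfandZetlin n = jucysMurphyAlg n := by
  apply le_antisymm
  · refine Algebra.adjoin_le ?_
    rintro _ ⟨m, _, h, c, hc, rfl⟩
    exact map_embed_jucysMurphyAlg_le h ⟨c, mem_jucysMurphyAlg_of_commute fun a =>
      ((Subalgebra.mem_center_iff.1 hc) _).symm, rfl⟩
  · refine Algebra.adjoin_le ?_
    have key : ∀ m (h : m ≤ n), ∑ i : Fin m, jucysMurphy (Fin.castLE h i) ∈ gelfandZetlin n := by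
      intro m h
      rcases Nat.eq_zero_or_pos m with rfl | hm
      · simp
      · refine Algebra.subset_adjoin ⟨m, hm, h, _, sum_jucysMurphy_mem_center m, ?_⟩
        simp only [map_sum, embed_jucysMurphy]
    rintro _ ⟨a, rfl⟩
    have h1 := key (a + 1) a.2
    rw [Fin.sum_univ_castSucc] at h1
    exact (add_mem_cancel_left (H := (gelfandZetlin n).toSubmodule.toAddSubgroup)
      (key a a.2.le)).1 h1

end Centralizer

/-! ### Passing between values and coefficients of polynomials -/

section PolynomialCoefficients

variable {n : ℕ}

theorem eval_algebraMap_eq_sum (P : (SymAlg n)[X]) (u : ℂ) :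
    P.eval (algebraMap ℂ (SymAlg n) u) =
      ∑ i ∈ Finset.range (P.natDegree + 1), u ^ i • P.coeff i := by
  rw [eval_eq_sum_range]
  refine Finset.sum_congr rfl fun i _ => ?_
  rw [← map_pow, ← Algebra.commutes, Algebra.smul_def]

theorem eval_algebraMap_mem {B : Subalgebra ℂ (SymAlg n)} {P : (SymAlg n)[X]}
    (h : ∀ i, P.coeff i ∈ B) (u : ℂ) : P.eval (algebraMap ℂ (SymAlg n) u) ∈ B := by
  rw [eval_algebraMap_eq_sum]
  exact sum_mem fun i _ => Subalgebra.smul_mem _ (h i) _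

/-- A linear map that kills infinitely many values of a polynomial kills its coefficients. -/
theorem map_coeff_eq_zero {m : ℕ} (f : SymAlg n →ₗ[ℂ] SymAlg m) {P : (SymAlg n)[X]} {S : Set ℂ}
    (hS : S.Infinite) (h : ∀ u ∈ S, f (P.eval (algebraMap ℂ (SymAlg n) u)) = 0) (i : ℕ) :
    f (P.coeff i) = 0 := by
  rcases lt_or_ge P.natDegree i with hi | hi
  · rw [coeff_eq_zero_of_natDegree_lt hi, map_zero]
  ext g
  set q : ℂ[X] := ∑ i ∈ Finset.range (P.natDegree + 1), monomial i ((f (P.coeff i)).coeff g) with hq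
  have hq0 : q = 0 := by
    refine eq_zero_of_infinite_isRoot q (hS.mono fun u hu => ?_)
    have h1 := congrArg (fun x => x.coeff g) (h u hu)
    simp only [eval_algebraMap_eq_sum, map_sum, map_smul, MonoidAlgebra.coeff_sum,
      Finsupp.finsetSum_apply, MonoidAlgebra.coeff_smul, Finsupp.smul_apply, smul_eq_mul] at h1
    simp only [Set.mem_ofPred_eq, IsRoot.def, hq, eval_finsetSum, eval_monomial]
    refine (Finset.sum_congr rfl fun i _ => mul_comm _ _).trans (h1.trans ?_)
    rw [MonoidAlgebra.coeff_zero, Finsupp.coe_zero, Pi.zero_apply]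
  have h2 := congrArg (fun p => p.coeff i) hq0
  simp only [hq, finsetSum_coeff, coeff_monomial, coeff_zero] at h2
  rw [Finset.sum_ite_eq' , if_pos (Finset.mem_range.2 (by omega))] at h2
  rw [h2]
  rfl

end PolynomialCoefficients

/-! ### Signed sums over subsets -/

section Antisymmetrizers

variable {n : ℕ}

/-- The signed sum of the permutations supported on `R`. -/
noncomputable def signedSum (R : Finset (Fin n)) : SymAlg n :=
  ∑ σ : Equiv.Perm (Fin n) with ∀ x, x ∉ R → σ x = x, ((Equiv.Perm.sign σ : ℤ) : ℂ) • perm σ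

theorem coeff_signedSum (R : Finset (Fin n)) (σ : Equiv.Perm (Fin n)) :
    (signedSum R).coeff σ =
      if ∀ x, x ∉ R → σ x = x then ((Equiv.Perm.sign σ : ℤ) : ℂ) else 0 := by
  rw [signedSum, MonoidAlgebra.coeff_sum, Finsupp.finsetSum_apply]
  simp [Finsupp.single_apply]

theorem perm_mul_signedSum (g : Equiv.Perm (Fin n)) (R : Finset (Fin n)) :
    perm g * signedSum R = signedSum (R.map g.toEmbedding) * perm g := by
  rw [signedSum, signedSum, Finset.mul_sum, Finset.sum_mul]
  refine Finset.sum_equiv (MulAut.conj g).toEquiv (fun σ => ?_) (fun σ _ => ?_)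
  · simp only [Finset.mem_filter, Finset.mem_univ, true_and, Finset.mem_map_equiv]
    constructor
    · intro h x hx
      simpa using congrArg g (h (g⁻¹ x) hx)
    · intro h x hx
      have := h (g x) (by simpa using hx)
      simpa using this
  · have h1 : (MulAut.conj g).toEquiv σ = g * σ * g⁻¹ := rfl
    rw [h1, mul_smul_comm, smul_mul_assoc, ← map_mul, ← map_mul, inv_mul_cancel_right,
      Equiv.Perm.sign_mul, Equiv.Perm.sign_mul, Equiv.Perm.sign_inv, mul_right_comm,
      Int.units_mul_self, one_mul]

theorem transp_mul_signedSum (a b : Fin n) (R : Finset (Fin n)) :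
    transp a b * signedSum R = signedSum (R.map (Equiv.swap a b).toEmbedding) * transp a b :=
  perm_mul_signedSum _ _

theorem map_swap_eq_self {a b : Fin n} {R : Finset (Fin n)} (h : a ∈ R ↔ b ∈ R) :
    R.map (Equiv.swap a b).toEmbedding = R := by
  ext x
  rw [Finset.mem_map_equiv, Equiv.symm_swap]
  by_cases ha : x = a
  · subst ha; rw [Equiv.swap_apply_left, h]
  by_cases hb : x = b
  · subst hb; rw [Equiv.swap_apply_right, h]
  rw [Equiv.swap_apply_of_ne_of_ne ha hb]

theorem map_swap_map_swap (a b : Fin n) (R : Finset (Fin n)) :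
    (R.map (Equiv.swap a b).toEmbedding).map (Equiv.swap a b).toEmbedding = R := by
  ext x
  simp [Finset.mem_map_equiv]

/-- A permutation of Q ∪ {c} either fixes c or is uniquely σ(c b) with σ supported on Q, where b is
the preimage of c; the transposition contributes the minus sign. -/
theorem signedSum_insert {c : Fin n} {Q : Finset (Fin n)} (hc : c ∉ Q) :
    signedSum (insert c Q) = signedSum Q - ∑ b ∈ Q, signedSum Q * transp c b := by
  ext σ
  rw [MonoidAlgebra.coeff_sub, Finsupp.sub_apply, MonoidAlgebra.coeff_sum, Finsupp.finsetSum_apply]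
  have hterm : ∀ b ∈ Q, (signedSum Q * transp c b).coeff σ =
      if σ b = c ∧ ∀ x, x ∉ insert c Q → σ x = x then -((Equiv.Perm.sign σ : ℤ) : ℂ) else 0 := by
    intro b hb
    have hbc : c ≠ b := fun h => hc (h ▸ hb)
    rw [transp, MonoidAlgebra.coeff_mul_single_apply, mul_one, Equiv.swap_inv, coeff_signedSum,
      Equiv.Perm.sign_mul, Equiv.Perm.sign_swap hbc]
    have hiff : (∀ x, x ∉ Q → (σ * Equiv.swap c b) x = x) ↔
        σ b = c ∧ ∀ x, x ∉ insert c Q → σ x = x := by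
      constructor
      · intro h
        refine ⟨by simpa using h c hc, fun x hx => ?_⟩
        rw [Finset.mem_insert, not_or] at hx
        have := h x hx.2
        rwa [Equiv.Perm.mul_apply, Equiv.swap_apply_of_ne_of_ne hx.1] at this
        rintro rfl
        exact hx.2 hb
      · rintro ⟨h1, h2⟩ x hx
        by_cases hxc : x = c
        · subst hxc
          rw [Equiv.Perm.mul_apply, Equiv.swap_apply_left, h1]
        rw [Equiv.Perm.mul_apply, Equiv.swap_apply_of_ne_of_ne hxc (fun h => hx (h ▸ hb))]
        exact h2 x (by simp [hxc, hx])
    rw [if_congr hiff rfl rfl]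
    simp
  rw [Finset.sum_congr rfl hterm, coeff_signedSum, coeff_signedSum]
  by_cases hσ : ∀ x, x ∉ insert c Q → σ x = x
  · simp only [eq_true hσ, and_true, if_true]
    by_cases hcc : σ c = c
    · rw [if_pos, Finset.sum_eq_zero, sub_zero]
      · intro b hb
        rw [if_neg]
        intro h
        exact hc (σ.injective (h.trans hcc.symm) ▸ hb)
      · intro x hx
        by_cases hxc : x = c
        · rw [hxc, hcc]
        · exact hσ x (by simp [hxc, hx])
    · rw [if_neg (fun h => hcc (h c hc))]
      have hb : σ⁻¹ c ∈ Q := by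
        by_contra hb
        have hne : σ⁻¹ c ≠ c := fun h => hcc (by simpa using (congrArg σ h).symm)
        have := hσ (σ⁻¹ c) (by rw [Finset.mem_insert, not_or]; exact ⟨hne, hb⟩)
        exact hne (this.symm.trans (σ.apply_symm_apply c))
      rw [Finset.sum_eq_single_of_mem _ hb]
      · simp
      · intro b _ hne
        rw [if_neg]
        rintro rfl
        simp at hne
  · have hσ' : ¬ ∀ x, x ∉ Q → σ x = x := fun h => hσ fun x hx => h x fun h' =>
      hx (Finset.mem_insert_of_mem h')
    rw [if_neg hσ, if_neg hσ', Finset.sum_eq_zero fun b _ => if_neg fun h => hσ h.2, sub_zero]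

/-- The adjoint of the previous identity: signed sums and transpositions are self-adjoint. -/
theorem signedSum_insert' {c : Fin n} {Q : Finset (Fin n)} (hc : c ∉ Q) :
    signedSum (insert c Q) = signedSum Q - ∑ b ∈ Q, transp c b * signedSum Q := by
  have h := congrArg adjoint (signedSum_insert hc)
  have hadj : ∀ R : Finset (Fin n), adjoint (signedSum R) = signedSum R := by
    intro R
    ext σ
    rw [coeff_adjoint, coeff_signedSum, coeff_signedSum, Equiv.Perm.sign_inv]
    have : (∀ x, x ∉ R → σ⁻¹ x = x) ↔ ∀ x, x ∉ R → σ x = x :=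
      forall₂_congr fun x _ => by rw [Equiv.Perm.inv_eq_iff_eq, eq_comm]
    simp only [this, apply_ite (starRingEnd ℂ), map_zero, map_intCast]
  have htr : ∀ a b : Fin n, adjoint (transp a b) = transp a b := fun a b => by
    rw [transp_eq_perm, adjoint_perm, Equiv.swap_inv]
  have hsub : ∀ x y : SymAlg n, adjoint (x - y) = adjoint x - adjoint y := fun x y => by
    ext; simp [coeff_adjoint]
  simpa only [hsub, adjoint_sum, adjoint_mul, hadj, htr] using h

/-- Both one-sided expansions compute the same signed sum on Q ∪ {c}. This is the only input to the
Gaudin commutation relation, and it reappears in the Yang–Baxter argument. -/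
theorem sum_transp_commute_signedSum {c : Fin n} {Q : Finset (Fin n)} (hc : c ∉ Q) :
    ∑ b ∈ Q, (transp c b * signedSum Q - signedSum Q * transp c b) = 0 := by
  rw [Finset.sum_sub_distrib, sub_eq_zero]
  exact sub_right_injective ((signedSum_insert' hc).symm.trans (signedSum_insert hc))

theorem signedSum_pair {a b : Fin n} (h : a ≠ b) : signedSum {a, b} = 1 - transp a b := by
  have h1 : signedSum ({b} : Finset (Fin n)) = 1 := by
    ext σ
    rw [coeff_signedSum, MonoidAlgebra.one_def, MonoidAlgebra.coeff_single, Finsupp.single_apply]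
    by_cases hσ : 1 = σ
    · subst hσ; simp
    · rw [if_neg, if_neg hσ]
      intro h
      refine hσ (Equiv.ext fun x => ?_)
      by_cases hx : x = b
      · subst hx
        by_contra hne
        have := h (σ x) (by simpa [eq_comm] using hne)
        exact hne (σ.injective this).symm
      · exact (h x (by simpa using hx)).symm
  rw [signedSum_insert (by simpa using h), h1, Finset.sum_singleton, one_mul]

theorem embed_antisymmetrizer {m : ℕ} (r : Fin m ↪ Fin n) :
    (m.factorial : ℂ) • embed r (antisymmetrizer m) = signedSum (Finset.univ.map r) := by
  rw [antisymmetrizer, map_smul, smul_smul,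
    mul_inv_cancel₀ (Nat.cast_ne_zero.2 m.factorial_ne_zero), one_smul, map_sum, signedSum]
  refine Finset.sum_bij (fun σ _ => Equiv.Perm.viaEmbeddingHom r σ) (fun σ _ => ?_)
    (fun _ _ _ _ h => Equiv.Perm.viaEmbeddingHom_injective r h) (fun τ hτ => ?_) (fun σ _ => ?_)
  · refine Finset.mem_filter.2 ⟨Finset.mem_univ _, fun x hx => ?_⟩
    exact Equiv.Perm.viaEmbedding_apply_of_notMem _ _ _ (by simpa using hx)
  · obtain ⟨σ, hσ⟩ := exists_viaEmbeddingHom_eq r (g := τ) fun x hx =>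
      (Finset.mem_filter.1 hτ).2 x (by simpa using hx)
    exact ⟨σ, Finset.mem_univ _, hσ⟩
  · rw [single_eq_smul_perm, map_smul, embed_perm, Equiv.Perm.viaEmbeddingHom_apply,
      Equiv.Perm.viaEmbedding, Equiv.Perm.sign_extendDomain]

end Antisymmetrizers

/-! ### Gaudin Hamiltonians in the Bethe subalgebra -/

section Gaudin

variable {n : ℕ}

theorem eval_gaudinPoly (z : Fin n → ℂ) (i : ℕ) (u : ℂ) :
    (gaudinPoly n z i).eval (algebraMap ℂ (SymAlg n) u) =
      ∑ R ∈ Finset.powersetCard i Finset.univ, (∏ a ∈ Rᶜ, (u - z a)) • signedSum R := by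
  rw [gaudinPoly, eval_finsetSum]
  refine Finset.sum_bij (fun r _ => Finset.univ.map r) (fun r _ => by simp) (fun r hr s hs h => ?_)
    (fun R hR => ?_) (fun r _ => ?_)
  · have hr' : StrictMono r := (Finset.mem_filter.1 hr).2
    have hs' : StrictMono s := (Finset.mem_filter.1 hs).2
    have h1 : Set.range r = Set.range s := by
      have := congrArg (fun R : Finset (Fin n) => (R : Set (Fin n))) h
      simpa using this
    have := hr'.range_inj hs' |>.1 h1
    exact DFunLike.coe_injective this
  · have hR := (Finset.mem_powersetCard.1 hR).2
    refine ⟨(R.orderEmbOfFin hR).toEmbedding, ?_, ?_⟩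
    · exact Finset.mem_filter.2 ⟨Finset.mem_univ _, (R.orderEmbOfFin hR).strictMono⟩
    · apply Finset.coe_injective
      simp
  · rw [eval_C_mul, embed_antisymmetrizer, eval_map_algebraMap, aeval_algebraMap_apply,
      ← Algebra.commutes, ← Algebra.smul_def]
    congr 1
    rw [coe_aeval_eq_eval, eval_prod]
    refine Finset.prod_congr (by ext; simp) fun a _ => by simp

theorem prod_compl_sub_prod_compl_swap (z : Fin n → ℂ) (u : ℂ) {b c : Fin n} {R : Finset (Fin n)}
    (hb : b ∈ R) (hc : c ∉ R) :
    ∏ a ∈ Rᶜ, (u - z a) - ∏ a ∈ (R.map (Equiv.swap c b).toEmbedding)ᶜ, (u - z a) =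
      (z b - z c) * ∏ a ∈ (insert c R)ᶜ, (u - z a) := by
  have hbc : c ≠ b := fun h => hc (h ▸ hb)
  have h1 : Rᶜ = insert c (insert c R)ᶜ := by
    ext x; by_cases hx : x = c <;> simp [hx, hc]
  have h2 : (R.map (Equiv.swap c b).toEmbedding)ᶜ = insert b (insert c R)ᶜ := by
    ext x
    rw [Finset.mem_compl, Finset.mem_map_equiv, Equiv.symm_swap]
    by_cases hx : x = c
    · subst hx; simp [hb, hbc]
    by_cases hx' : x = b
    · subst hx'; simp [hc]
    rw [Equiv.swap_apply_of_ne_of_ne hx hx']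
    simp [hx, hx']
  rw [h1, h2, Finset.prod_insert (by simp), Finset.prod_insert (by simp [hb])]
  ring

/-- The quadratic Gaudin Hamiltonians commute with the generators of the Bethe subalgebra. -/
theorem commute_hamiltonian_eval_gaudinPoly (z : Fin n → ℂ) (c : Fin n) (κ : Fin n → ℂ) (δ : ℂ)
    (hκ : ∀ b, b ≠ c → κ b * (z c - z b) = δ) (i : ℕ) (u : ℂ) :
    Commute (∑ b with b ≠ c, κ b • transp c b)
      ((gaudinPoly n z i).eval (algebraMap ℂ (SymAlg n) u)) := by
  rw [eval_gaudinPoly]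
  set f : Finset (Fin n) → ℂ := fun R => ∏ a ∈ Rᶜ, (u - z a) with hf
  set W := Finset.powersetCard i (Finset.univ : Finset (Fin n)) with hW
  set F : Fin n → Finset (Fin n) → SymAlg n := fun b R =>
    transp c b * signedSum R - signedSum R * transp c b with hF
  have hswapW : ∀ b : Fin n, ∀ G : Finset (Fin n) → SymAlg n,
      ∑ R ∈ W, G R = ∑ R ∈ W, G (R.map (Equiv.swap c b).toEmbedding) := by
    intro b G
    have hmem : ∀ R ∈ W, R.map (Equiv.swap c b).toEmbedding ∈ W := fun R hR => by
      simpa [hW, Finset.mem_powersetCard] using hR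
    refine Finset.sum_bij' (fun R _ => R.map (Equiv.swap c b).toEmbedding)
      (fun R _ => R.map (Equiv.swap c b).toEmbedding) hmem hmem
      (fun R _ => map_swap_map_swap _ _ _) (fun R _ => map_swap_map_swap _ _ _) (fun R _ => ?_)
    simp only [map_swap_map_swap]
  have hF0 : ∀ b R, (c ∈ R ↔ b ∈ R) → F b R = 0 := fun b R h => by
    rw [hF]
    simp only
    rw [transp_mul_signedSum, map_swap_eq_self h, sub_self]
  have hFswap : ∀ b R, F b (R.map (Equiv.swap c b).toEmbedding) = - F b R := fun b R => by
    simp only [hF]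
    rw [transp_mul_signedSum c b (R.map _), map_swap_map_swap, ← transp_mul_signedSum c b R,
      neg_sub]
  -- Only sets containing exactly one of b, c contribute. Pairing R with its image under (c b) turns
  -- f(R) into a difference divisible by z_b − z_c, which κ_b cancels to a coefficient independent
  -- of b; the sum over b ∈ R then vanishes.
  have hD : ∀ b, b ≠ c → κ b • ∑ R ∈ W, f R • F b R =
      ∑ R ∈ W, if c ∉ R ∧ b ∈ R then (-δ * f (insert c R)) • F b R else 0 := by
    intro b hb
    have hsplit : ∑ R ∈ W, f R • F b R = ∑ R ∈ W, (if c ∉ R ∧ b ∈ R then f R • F b R else 0) +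
        ∑ R ∈ W, (if c ∈ R ∧ b ∉ R then f R • F b R else 0) := by
      rw [← Finset.sum_add_distrib]
      refine Finset.sum_congr rfl fun R _ => ?_
      by_cases h1 : c ∈ R <;> by_cases h2 : b ∈ R <;> simp [h1, h2, hF0]
    rw [hsplit, hswapW b (fun R => if c ∈ R ∧ b ∉ R then f R • F b R else 0),
      ← Finset.sum_add_distrib, Finset.smul_sum]
    refine Finset.sum_congr rfl fun R _ => ?_
    simp only [Finset.mem_map_equiv, Equiv.symm_swap, Equiv.swap_apply_left,
      Equiv.swap_apply_right, hFswap]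
    by_cases h1 : c ∈ R <;> by_cases h2 : b ∈ R <;> simp only [h1, h2, not_true_eq_false,
      not_false_eq_true, and_true, and_false, if_true, if_false, add_zero, smul_zero]
    rw [smul_neg, ← sub_eq_add_neg, ← sub_smul, smul_smul]
    congr 1
    rw [hf]
    simp only
    rw [prod_compl_sub_prod_compl_swap z u h2 h1, ← hκ b hb]
    ring
  have hexp : (∑ b with b ≠ c, κ b • transp c b) * ∑ R ∈ W, f R • signedSum R -
      (∑ R ∈ W, f R • signedSum R) * ∑ b with b ≠ c, κ b • transp c b =
        ∑ b with b ≠ c, κ b • ∑ R ∈ W, f R • F b R := by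
    rw [Finset.sum_mul, Finset.mul_sum, ← Finset.sum_sub_distrib]
    refine Finset.sum_congr rfl fun b _ => ?_
    rw [smul_mul_assoc, mul_smul_comm, ← smul_sub, Finset.mul_sum, Finset.sum_mul,
      ← Finset.sum_sub_distrib]
    simp only [hF, mul_smul_comm, smul_mul_assoc, smul_sub]
  refine sub_eq_zero.1 (hexp.trans ?_)
  rw [Finset.sum_congr rfl fun b hb => hD b (Finset.mem_filter.1 hb).2, Finset.sum_comm]
  refine Finset.sum_eq_zero fun R _ => ?_
  by_cases hcR : c ∈ R
  · simp [hcR]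
  · have h3 := sum_transp_commute_signedSum hcR
    simp only [hcR, not_false_eq_true, true_and]
    rw [← Finset.sum_filter, ← Finset.smul_sum]
    have h4 : (Finset.univ.filter fun b => b ≠ c).filter (fun b => b ∈ R) = R := by
      ext b
      simp only [Finset.mem_filter, Finset.mem_univ, true_and, and_iff_right_iff_imp]
      rintro hb rfl
      exact hcR hb
    rw [h4, h3, smul_zero]

theorem commute_hamiltonian_of_mem_betheGaudin (z : Fin n → ℂ) (c : Fin n) (κ : Fin n → ℂ) (δ : ℂ)
    (hκ : ∀ b, b ≠ c → κ b * (z c - z b) = δ) {y : SymAlg n} (hy : y ∈ betheGaudin n z) :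
    Commute y (∑ b with b ≠ c, κ b • transp c b) := by
  set H := ∑ b with b ≠ c, κ b • transp c b with hH
  induction hy using Algebra.adjoin_induction with
  | mem y h =>
    obtain ⟨i, j, _, _, rfl⟩ := h
    refine sub_eq_zero.1 (map_coeff_eq_zero (LinearMap.mulRight ℂ H - LinearMap.mulLeft ℂ H)
      (S := Set.univ) Set.infinite_univ (fun u _ => ?_) _)
    exact sub_eq_zero.2 (commute_hamiltonian_eval_gaudinPoly z c κ δ hκ i u).eq.symm
  | algebraMap r => exact Algebra.commutes r H
  | add a b _ _ ha hb => exact ha.add_left hb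
  | mul a b _ _ ha hb => exact ha.mul_left hb

theorem natDegree_gaudinPoly_le (z : Fin n → ℂ) (i : ℕ) :
    (gaudinPoly n z i).natDegree ≤ n - i := by
  rw [gaudinPoly]
  refine natDegree_sum_le_of_forall_le _ _ fun r _ => ?_
  refine (natDegree_C_mul_le _ _).trans (natDegree_map_le.trans ((natDegree_prod_le _ _).trans ?_))
  refine (Finset.sum_le_sum fun a _ => (natDegree_X_sub_C (z a)).le).trans ?_
  rw [Finset.sum_const, smul_eq_mul, mul_one]
  have h : (Finset.univ.filter fun a => a ∉ Set.range r) = (Finset.univ.map r)ᶜ := by ext; simp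
  rw [h, Finset.card_compl]
  simp

theorem coeff_gaudinPoly_mem (z : Fin n → ℂ) {i : ℕ} (h1 : 1 ≤ i) (h2 : i ≤ n) (k : ℕ) :
    (gaudinPoly n z i).coeff k ∈ betheGaudin n z := by
  rcases le_or_gt k (n - i) with hk | hk
  · refine Algebra.subset_adjoin ⟨i, n - i - k, h1, by omega, ?_⟩
    congr 1
    omega
  · rw [coeff_eq_zero_of_natDegree_lt ((natDegree_gaudinPoly_le z i).trans_lt hk)]
    exact zero_mem _

/-- The quadratic Gaudin Hamiltonians belong to the Bethe subalgebra. Parameters `z a`, `z a'` are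
allowed to coincide. -/
theorem hamiltonian_mem_betheGaudin (z : Fin n → ℂ) {a a' : Fin n} (ha : a' ≠ a)
    (hz : ∀ b, b ≠ a → b ≠ a' → z a ≠ z b) (κ : Fin n → ℂ) (hκ' : κ a' = 1)
    (hκ : ∀ b, b ≠ a → κ b * (z a - z b) = z a - z a') :
    ∑ b with b ≠ a, κ b • transp a b ∈ betheGaudin n z := by
  have hn : 2 ≤ n := by
    have h1 := a.2
    have h2 := a'.2
    have h3 : (a' : ℕ) ≠ a := fun h => ha (Fin.ext h)
    omega
  set D := ∏ c ∈ ({a, a'} : Finset (Fin n))ᶜ, (z a - z c) with hD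
  have hD0 : D ≠ 0 := Finset.prod_ne_zero_iff.2 fun c hc => by
    simp only [Finset.mem_compl, Finset.mem_insert, Finset.mem_singleton, not_or] at hc
    exact sub_ne_zero.2 (hz c hc.1 hc.2)
  -- The case b = a' is separate because z_a = z_{a'} is permitted; elsewhere one cancels the
  -- nonzero z_a − z_b.
  have hprod : ∀ b, b ≠ a → ∏ c ∈ ({a, b} : Finset (Fin n))ᶜ, (z a - z c) = D * κ b := by
    intro b hb
    by_cases hb' : b = a'
    · subst hb'; rw [hκ', mul_one]
    have hcompl : ∀ b, b ≠ a → (z a - z b) * ∏ c ∈ ({a, b} : Finset (Fin n))ᶜ, (z a - z c) =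
        ∏ c ∈ ({a} : Finset (Fin n))ᶜ, (z a - z c) := by
      intro b hb
      rw [← Finset.prod_insert (s := ({a, b} : Finset (Fin n))ᶜ) (f := fun c => z a - z c) (by simp)]
      congr 1
      ext x
      by_cases hx : x = b <;> simp [hx, hb]
    have h1 := hcompl b hb
    rw [← hcompl a' ha, ← hκ b hb] at h1
    refine mul_left_cancel₀ (sub_ne_zero.2 (hz b hb hb')) (h1.trans ?_)
    ring
  -- At u = z_a a pair not containing a has a vanishing factor in its coefficient.
  have hE : (gaudinPoly n z 2).eval (algebraMap ℂ (SymAlg n) (z a)) =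
      D • ∑ b with b ≠ a, κ b • (1 - transp a b) := by
    rw [eval_gaudinPoly, ← Finset.sum_filter_add_sum_filter_not _ (fun R => a ∈ R),
      Finset.sum_eq_zero (s := Finset.filter (fun R => ¬ a ∈ R) _), add_zero, Finset.smul_sum]
    · symm
      refine Finset.sum_bij (fun b _ => {a, b}) (fun b hb => ?_) (fun b hb b' hb' h => ?_)
        (fun R hR => ?_) (fun b hb => ?_)
      · have hb : b ≠ a := (Finset.mem_filter.1 hb).2
        simp [Finset.mem_powersetCard, Finset.card_pair hb.symm]
      · have hb : b ≠ a := (Finset.mem_filter.1 hb).2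
        have : b ∈ ({a, b'} : Finset (Fin n)) := h ▸ by simp
        simpa [hb] using this
      · obtain ⟨hR, haR⟩ := Finset.mem_filter.1 hR
        obtain ⟨x, y, hxy, rfl⟩ := Finset.card_eq_two.1 (Finset.mem_powersetCard.1 hR).2
        rcases Finset.mem_insert.1 haR with rfl | h
        · exact ⟨y, by simpa using hxy.symm, rfl⟩
        · rw [Finset.mem_singleton] at h
          subst h
          exact ⟨x, by simpa using hxy, Finset.pair_comm _ _⟩
      · have hb : b ≠ a := (Finset.mem_filter.1 hb).2
        rw [hprod b hb, signedSum_pair hb.symm, smul_smul]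
    · intro R hR
      rw [Finset.prod_eq_zero (Finset.mem_compl.2 (Finset.mem_filter.1 hR).2) (sub_self _),
        zero_smul]
  have hmem : D • ∑ b with b ≠ a, κ b • (1 - transp a b) ∈ betheGaudin n z :=
    hE ▸ eval_algebraMap_mem (coeff_gaudinPoly_mem z one_le_two hn) _
  have hfin : ∑ b with b ≠ a, κ b • transp a b = (∑ b with b ≠ a, κ b) • (1 : SymAlg n) -
      D⁻¹ • (D • ∑ b with b ≠ a, κ b • (1 - transp a b)) := by
    rw [smul_smul, inv_mul_cancel₀ hD0, one_smul]
    simp only [smul_sub, Finset.sum_sub_distrib, Finset.sum_smul, sub_sub_cancel]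
  rw [hfin]
  exact sub_mem (Subalgebra.smul_mem _ (one_mem _) _) (Subalgebra.smul_mem _ hmem _)

end Gaudin

/-! ### Orbit counts -/

section NumOrbits

variable {n m : ℕ}

theorem numOrbits_conj (g σ : Equiv.Perm (Fin n)) : numOrbits (g * σ * g⁻¹) = numOrbits σ := by
  refine Nat.card_congr (Quotient.congr g⁻¹ fun x y => ?_)
  exact Equiv.Perm.sameCycle_conj

theorem numOrbits_mul_comm (σ τ : Equiv.Perm (Fin n)) : numOrbits (σ * τ) = numOrbits (τ * σ) := by
  rw [← numOrbits_conj τ (σ * τ)]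
  congr 1
  group

theorem numOrbits_le (σ : Equiv.Perm (Fin n)) : numOrbits σ ≤ n := by
  have := Nat.card_le_card_of_surjective _
    (Quotient.mk_surjective (s := Equiv.Perm.SameCycle.setoid σ))
  simpa [numOrbits] using this

theorem eq_one_of_numOrbits_eq {σ : Equiv.Perm (Fin n)} (h : numOrbits σ = n) : σ = 1 := by
  have hs := Quotient.mk_surjective (s := Equiv.Perm.SameCycle.setoid σ)
  have hb := (Nat.bijective_iff_surjective_and_card _).2
    ⟨hs, (by rw [Nat.card_eq_fintype_card, Fintype.card_fin]; exact h.symm)⟩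
  ext x
  have h1 : (Quotient.mk (Equiv.Perm.SameCycle.setoid σ) (σ x)) = Quotient.mk _ x :=
    Quotient.sound (Equiv.Perm.sameCycle_apply_left.2 (Equiv.Perm.SameCycle.refl σ x))
  rw [hb.1 h1]
  rfl

theorem numOrbits_one : numOrbits (1 : Equiv.Perm (Fin n)) = n := by
  have hb : Function.Bijective (Quotient.mk (Equiv.Perm.SameCycle.setoid (1 : Equiv.Perm (Fin n)))) :=
    ⟨fun x y h => Equiv.Perm.sameCycle_one.1 (Quotient.exact h), Quotient.mk_surjective⟩
  rw [numOrbits, ← Nat.card_congr (Equiv.ofBijective _ hb), Nat.card_eq_fintype_card, Fintype.card_fin]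

theorem numOrbits_eq_ncard_classes (σ : Equiv.Perm (Fin n)) :
    numOrbits σ = (Equiv.Perm.SameCycle.setoid σ).classes.ncard :=
  Nat.card_congr (Setoid.quotientEquivClasses _)

end NumOrbits

/-! ### Removing symbols from the cycle notation -/

section RemoveSymbols

variable {n m : ℕ}

/-- The standard embedding `𝔖ₙ → 𝔖ₙ₊ₘ`. -/
noncomputable abbrev extendPerm (m : ℕ) {n : ℕ} : Equiv.Perm (Fin n) →* Equiv.Perm (Fin (n + m)) :=
  Equiv.Perm.viaEmbeddingHom (Fin.castAddEmb m)

theorem extendPerm_castAdd (τ : Equiv.Perm (Fin n)) (x : Fin n) :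
    extendPerm m τ (Fin.castAdd m x) = Fin.castAdd m (τ x) :=
  Equiv.Perm.viaEmbedding_apply τ (Fin.castAddEmb m) x

theorem extendPerm_of_le (τ : Equiv.Perm (Fin n)) {x : Fin (n + m)} (hx : n ≤ x) :
    extendPerm m τ x = x := by
  refine Equiv.Perm.viaEmbedding_apply_of_notMem _ _ _ ?_
  rintro ⟨y, rfl⟩
  have : ((Fin.castAddEmb m y : Fin (n + m)) : ℕ) = y := rfl
  omega

theorem exists_castAdd_eq {x : Fin (n + m)} (hx : (x : ℕ) < n) : ∃ y, Fin.castAdd m y = x :=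
  ⟨⟨x, hx⟩, rfl⟩

/-- The extension of τ acts only at the start of an excursion into the removed symbols, since it
fixes all of those. -/
theorem removeSymbols_mul_extendPerm (σ : Equiv.Perm (Fin (n + m))) (τ : Equiv.Perm (Fin n)) :
    removeSymbols (σ * extendPerm m τ) = removeSymbols σ * τ := by
  ext x
  have hpow : ∀ k, (∀ j < k, ¬ ((σ ^ (j + 1)) (Fin.castAdd m (τ x)) : ℕ) < n) →
      ((σ * extendPerm m τ) ^ (k + 1)) (Fin.castAdd m x) =
        (σ ^ (k + 1)) (Fin.castAdd m (τ x)) := by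
    intro k
    induction k with
    | zero => intro _; simp [extendPerm_castAdd]
    | succ k ih =>
      intro h
      rw [pow_succ' _ (k + 1), Equiv.Perm.mul_apply, ih fun j hj => h j (by omega),
        Equiv.Perm.mul_apply, extendPerm_of_le _ (not_lt.1 (h k (by omega))), ← Equiv.Perm.mul_apply,
        ← pow_succ']
  have hmin : ∀ j < returnTime σ (τ x), ¬ ((σ ^ (j + 1)) (Fin.castAdd m (τ x)) : ℕ) < n :=
    fun j hj => Nat.find_min (exists_return σ (τ x)) hj
  have hrt : returnTime (σ * extendPerm m τ) x = returnTime σ (τ x) := by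
    refine (Nat.find_eq_iff _).2 ⟨?_, fun j hj => ?_⟩
    · rw [hpow _ hmin]
      exact Nat.find_spec (exists_return σ (τ x))
    · rw [hpow j fun i hi => hmin i (hi.trans hj)]
      exact hmin j hj
  change (((σ * extendPerm m τ) ^ (returnTime (σ * extendPerm m τ) x + 1)) (Fin.castAdd m x) : ℕ) =
    ((σ ^ (returnTime σ (τ x) + 1)) (Fin.castAdd m (τ x)) : ℕ)
  rw [hrt, hpow _ hmin]

theorem castAdd_removeSymbols (σ : Equiv.Perm (Fin (n + m))) (x : Fin n) :
    Fin.castAdd m (removeSymbols σ x) = (σ ^ (returnTime σ x + 1)) (Fin.castAdd m x) := rfl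

theorem sameCycle_removeSymbols_iff (σ : Equiv.Perm (Fin (n + m))) (x y : Fin n) :
    (removeSymbols σ).SameCycle x y ↔ σ.SameCycle (Fin.castAdd m x) (Fin.castAdd m y) := by
  constructor
  · intro h
    obtain ⟨k, _, rfl⟩ := h.exists_pow_eq'
    clear h
    induction k with
    | zero => exact Equiv.Perm.SameCycle.refl _ _
    | succ k ih =>
      rw [pow_succ', Equiv.Perm.mul_apply, castAdd_removeSymbols]
      exact Equiv.Perm.sameCycle_pow_right.2 (ih (by omega))
  · intro h
    obtain ⟨k, _, hk⟩ := h.exists_pow_eq'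
    clear h
    induction k using Nat.strong_induction_on generalizing x with
    | _ k ih =>
      rcases k with _ | k
      · have : x = y := by simpa using hk
        rw [this]
      have hle : returnTime σ x ≤ k := Nat.find_min' _ (by rw [hk]; exact y.2)
      have h1 := ih (k - returnTime σ x) (by omega) (removeSymbols σ x) (by omega) (by
        rw [castAdd_removeSymbols, ← Equiv.Perm.mul_apply, ← pow_add, ← hk]
        congr 2
        omega)
      exact Equiv.Perm.sameCycle_apply_left.1 h1

/-- The orbits of `σ` all of whose members get removed. -/
def removedOrbits (σ : Equiv.Perm (Fin (n + m))) : Set (Set (Fin (n + m))) :=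
  {S | S ∈ (Equiv.Perm.SameCycle.setoid σ).classes ∧ ∀ x : Fin n, Fin.castAdd m x ∉ S}

/-- Orbits meeting the first n symbols correspond to orbits after removal, by preimage. In
particular the truncated subtraction in the exponent of p is a true difference. -/
theorem numOrbits_eq_add (σ : Equiv.Perm (Fin (n + m))) :
    numOrbits σ = numOrbits (removeSymbols σ) + (removedOrbits σ).ncard := by
  set C := (Equiv.Perm.SameCycle.setoid σ).classes with hC
  have hfin : C.Finite := Set.toFinite _
  have h1 : (C \ removedOrbits σ).ncard = numOrbits (removeSymbols σ) := by
    rw [numOrbits_eq_ncard_classes]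
    have himg : (fun S : Set (Fin (n + m)) => Fin.castAdd m ⁻¹' S) '' (C \ removedOrbits σ) =
        (Equiv.Perm.SameCycle.setoid (removeSymbols σ)).classes := by
      ext S
      constructor
      · rintro ⟨T, ⟨hT, hT'⟩, rfl⟩
        simp only [removedOrbits, Set.mem_ofPred_eq, not_and, not_forall, not_not] at hT'
        obtain ⟨x, hx⟩ := hT' hT
        obtain ⟨y, rfl⟩ := hT
        refine ⟨x, ?_⟩
        ext w
        have hx : σ.SameCycle (Fin.castAdd m x) y := hx
        change σ.SameCycle (Fin.castAdd m w) y ↔ (removeSymbols σ).SameCycle w x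
        rw [sameCycle_removeSymbols_iff]
        exact ⟨fun h => h.trans hx.symm, fun h => h.trans hx⟩
      · rintro ⟨x, rfl⟩
        refine ⟨{w | σ.SameCycle w (Fin.castAdd m x)}, ⟨⟨_, rfl⟩, fun h => ?_⟩, ?_⟩
        · exact h.2 x (Equiv.Perm.SameCycle.refl _ _)
        · ext w
          exact (sameCycle_removeSymbols_iff σ w x).symm
    rw [← himg, Set.InjOn.ncard_image]
    rintro S ⟨hS, hS'⟩ T ⟨hT, _⟩ hST
    simp only [removedOrbits, Set.mem_ofPred_eq, not_and, not_forall, not_not] at hS'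
    obtain ⟨x, hx⟩ := hS' hS
    have hx' : x ∈ Fin.castAdd m ⁻¹' T := by
      have : x ∈ Fin.castAdd m ⁻¹' S := hx
      rwa [show Fin.castAdd m ⁻¹' S = Fin.castAdd m ⁻¹' T from hST] at this
    exact Setoid.eq_of_mem_classes hS hx hT hx'
  have hsub : removedOrbits σ ⊆ C := fun S hS => hS.1
  rw [numOrbits_eq_ncard_classes, ← h1, Set.ncard_sdiff_add_ncard_of_subset hsub]

theorem removedOrbits_subset (σ : Equiv.Perm (Fin (n + m))) (τ : Equiv.Perm (Fin n)) :
    removedOrbits σ ⊆ removedOrbits (σ * extendPerm m τ) := by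
  rintro S ⟨⟨y, rfl⟩, hS⟩
  have hS : ∀ x : Fin n, ¬ σ.SameCycle (Fin.castAdd m x) y := hS
  have hge : ∀ w, σ.SameCycle w y → n ≤ (w : ℕ) := by
    intro w hw
    by_contra hlt
    obtain ⟨x, rfl⟩ := exists_castAdd_eq (not_le.1 hlt)
    exact hS x hw
  have hpow : ∀ k : ℕ, ((σ * extendPerm m τ) ^ k) y = (σ ^ k) y := by
    intro k
    induction k with
    | zero => rfl
    | succ k ih =>
      rw [pow_succ', Equiv.Perm.mul_apply, ih, Equiv.Perm.mul_apply, extendPerm_of_le,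
        ← Equiv.Perm.mul_apply, ← pow_succ']
      exact hge _ (Equiv.Perm.sameCycle_pow_left.2 (Equiv.Perm.SameCycle.refl _ _))
  have hiff : ∀ w, σ.SameCycle w y ↔ (σ * extendPerm m τ).SameCycle w y := by
    intro w
    constructor
    · intro h
      obtain ⟨k, _, rfl⟩ := h.symm.exists_pow_eq'
      rw [← hpow]
      exact Equiv.Perm.sameCycle_pow_left.2 (Equiv.Perm.SameCycle.refl _ _)
    · intro h
      obtain ⟨k, _, rfl⟩ := h.symm.exists_pow_eq'
      rw [hpow]
      exact Equiv.Perm.sameCycle_pow_left.2 (Equiv.Perm.SameCycle.refl _ _)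
  refine ⟨⟨y, Set.ext hiff⟩, hS⟩

theorem removedOrbits_mul_extendPerm (σ : Equiv.Perm (Fin (n + m))) (τ : Equiv.Perm (Fin n)) :
    removedOrbits (σ * extendPerm m τ) = removedOrbits σ := by
  refine (Set.Subset.antisymm ?_ (removedOrbits_subset σ τ))
  have := removedOrbits_subset (σ * extendPerm m τ) τ⁻¹
  rwa [mul_assoc, ← map_mul, mul_inv_cancel, map_one, mul_one] at this

/-- The numbers of orbits of the products `σ τ`, `τ ∈ 𝔖ₙ`, determine `removeSymbols σ`. -/
theorem numOrbits_mul_extendPerm (σ : Equiv.Perm (Fin (n + m))) (τ : Equiv.Perm (Fin n)) :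
    numOrbits (σ * extendPerm m τ) =
      (numOrbits σ - numOrbits (removeSymbols (n := n) σ)) + numOrbits (removeSymbols σ * τ) := by
  rw [numOrbits_eq_add (n := n) (σ * _), numOrbits_eq_add (n := n) σ, removedOrbits_mul_extendPerm,
    removeSymbols_mul_extendPerm]
  omega

/-- Test against ρ⁻¹ and against the inverse of the reduced permutation: the maximal orbit count n
is attained only at the identity. Identities for the partial trace thereby become identities of
orbit counts, which are invariant under cyclic rotation of products. -/
theorem removeSymbols_unique {σ : Equiv.Perm (Fin (n + m))} {ρ : Equiv.Perm (Fin n)} {d : ℕ}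
    (h : ∀ τ : Equiv.Perm (Fin n), numOrbits (σ * extendPerm m τ) = d + numOrbits (ρ * τ)) :
    removeSymbols σ = ρ ∧ numOrbits σ - numOrbits (removeSymbols (n := n) σ) = d := by
  have h1 := h ρ⁻¹
  have h2 := h (removeSymbols σ)⁻¹
  rw [numOrbits_mul_extendPerm, mul_inv_cancel, numOrbits_one] at h1 h2
  have h3 := numOrbits_le (removeSymbols σ * ρ⁻¹)
  have h4 := numOrbits_le (ρ * (removeSymbols σ)⁻¹)
  refine ⟨?_, by omega⟩
  have h5 : removeSymbols σ * ρ⁻¹ = 1 := eq_one_of_numOrbits_eq (by omega)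
  exact mul_inv_eq_one.1 h5

end RemoveSymbols

/-! ### Algebraic properties of the partial trace -/

section PartialTrace

variable {n m : ℕ} (p : ℂ)

/-- The partial trace as a linear map. -/
noncomputable def partialTraceLin (n m : ℕ) (p : ℂ) : SymAlg (n + m) →ₗ[ℂ] SymAlg n where
  toFun := partialTrace p
  map_add' x y := by
    simp only [partialTrace, MonoidAlgebra.coeff_add, Finsupp.add_apply, add_mul,
      MonoidAlgebra.single_add, Finset.sum_add_distrib]
  map_smul' c x := by
    simp only [partialTrace, MonoidAlgebra.coeff_smul, Finsupp.smul_apply, smul_eq_mul, mul_assoc,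
      Finset.smul_sum, MonoidAlgebra.smul_single, RingHom.id_apply]

theorem partialTraceLin_perm (σ : Equiv.Perm (Fin (n + m))) :
    partialTraceLin n m p (perm σ) =
      p ^ (numOrbits σ - numOrbits (removeSymbols (n := n) σ)) • perm (removeSymbols σ) := by
  change partialTrace p _ = _
  rw [partialTrace, Finset.sum_eq_single σ]
  · simp
  · intro τ _ hτ
    rw [MonoidAlgebra.of_apply, MonoidAlgebra.coeff_single, Finsupp.single_eq_of_ne hτ, zero_mul,
      MonoidAlgebra.single_zero]
  · simp

theorem partialTraceLin_perm_of_forall {σ : Equiv.Perm (Fin (n + m))} {ρ : Equiv.Perm (Fin n)}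
    {d : ℕ}
    (h : ∀ τ : Equiv.Perm (Fin n), numOrbits (σ * extendPerm m τ) = d + numOrbits (ρ * τ)) :
    partialTraceLin n m p (perm σ) = p ^ d • perm ρ := by
  rw [partialTraceLin_perm, (removeSymbols_unique h).2, (removeSymbols_unique h).1]

theorem symAlg_induction {n : ℕ} {P : SymAlg n → Prop} (hperm : ∀ g, P (perm g))
    (hadd : ∀ x y, P x → P y → P (x + y)) (hsmul : ∀ (c : ℂ) x, P x → P (c • x)) (x : SymAlg n) :
    P x :=
  MonoidAlgebra.induction_on x hperm hadd hsmul

theorem partialTraceLin_mul_embed (x : SymAlg (n + m)) (y : SymAlg n) :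
    partialTraceLin n m p (x * embed (Fin.castAddEmb m) y) = partialTraceLin n m p x * y := by
  induction x using symAlg_induction with
  | hperm σ =>
    induction y using symAlg_induction with
    | hperm τ =>
      rw [embed_perm, ← map_mul, partialTraceLin_perm p σ, smul_mul_assoc, ← map_mul]
      refine partialTraceLin_perm_of_forall p fun τ' => ?_
      rw [mul_assoc, ← map_mul, numOrbits_mul_extendPerm, mul_assoc]
    | hadd x y hx hy => rw [map_add, mul_add, map_add, hx, hy, mul_add]
    | hsmul c x hx => rw [map_smul, mul_smul_comm, map_smul, hx, mul_smul_comm]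
  | hadd x y hx hy => rw [add_mul, map_add, hx, hy, map_add, add_mul]
  | hsmul c x hx => rw [smul_mul_assoc, map_smul, hx, map_smul, smul_mul_assoc]

theorem partialTraceLin_embed_mul (x : SymAlg (n + m)) (y : SymAlg n) :
    partialTraceLin n m p (embed (Fin.castAddEmb m) y * x) = y * partialTraceLin n m p x := by
  induction x using symAlg_induction with
  | hperm σ =>
    induction y using symAlg_induction with
    | hperm τ =>
      rw [embed_perm, ← map_mul, partialTraceLin_perm p σ, mul_smul_comm, ← map_mul]
      refine partialTraceLin_perm_of_forall p fun τ' => ?_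
      rw [mul_assoc, numOrbits_mul_comm, mul_assoc, ← map_mul, numOrbits_mul_extendPerm,
        ← mul_assoc, numOrbits_mul_comm, mul_assoc]
    | hadd x y hx hy => rw [map_add, add_mul, map_add, hx, hy, add_mul]
    | hsmul c x hx => rw [map_smul, smul_mul_assoc, map_smul, hx, smul_mul_assoc]
  | hadd x y hx hy => rw [mul_add, map_add, hx, hy, map_add, mul_add]
  | hsmul c x hx => rw [mul_smul_comm, map_smul, hx, map_smul, mul_smul_comm]

theorem commute_extendPerm {g : Equiv.Perm (Fin (n + m))}
    (hg : ∀ x, g (Fin.castAdd m x) = Fin.castAdd m x) (τ : Equiv.Perm (Fin n)) :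
    extendPerm m τ * g = g * extendPerm m τ := by
  ext w
  congr 1
  rcases lt_or_ge (w : ℕ) n with hw | hw
  · obtain ⟨x, rfl⟩ := exists_castAdd_eq hw
    rw [Equiv.Perm.mul_apply, Equiv.Perm.mul_apply, hg, extendPerm_castAdd, hg]
  · have hgw : n ≤ (g w : ℕ) := by
      by_contra hlt
      obtain ⟨x, hx⟩ := exists_castAdd_eq (not_le.1 hlt)
      have := g.injective ((hg x).trans hx)
      rw [← this] at hw
      exact absurd x.2 (not_lt.2 hw)
    rw [Equiv.Perm.mul_apply, Equiv.Perm.mul_apply, extendPerm_of_le _ hw, extendPerm_of_le _ hgw]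

/-- The partial trace is cyclic with respect to permutations of the removed symbols. -/
theorem partialTraceLin_perm_mul_comm {g : Equiv.Perm (Fin (n + m))}
    (hg : ∀ x, g (Fin.castAdd m x) = Fin.castAdd m x) (x : SymAlg (n + m)) :
    partialTraceLin n m p (perm g * x) = partialTraceLin n m p (x * perm g) := by
  induction x using symAlg_induction with
  | hperm σ =>
    rw [← map_mul, ← map_mul, partialTraceLin_perm p (σ * g)]
    refine partialTraceLin_perm_of_forall p fun τ => ?_
    rw [← numOrbits_mul_extendPerm, mul_assoc, numOrbits_mul_comm, mul_assoc, commute_extendPerm hg,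
      mul_assoc]
  | hadd x y hx hy => rw [mul_add, map_add, hx, hy, ← map_add, ← add_mul]
  | hsmul c x hx => rw [mul_smul_comm, map_smul, hx, ← map_smul, smul_mul_assoc]

theorem extendPerm_extendPerm (τ : Equiv.Perm (Fin n)) :
    extendPerm 1 (extendPerm m τ) = extendPerm (m + 1) τ := by
  ext w
  congr 1
  rcases lt_or_ge (w : ℕ) (n + m) with hw | hw
  · obtain ⟨x, rfl⟩ := exists_castAdd_eq (m := 1) hw
    rw [extendPerm_castAdd]
    rcases lt_or_ge (x : ℕ) n with hx | hx
    · obtain ⟨y, rfl⟩ := exists_castAdd_eq hx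
      rw [extendPerm_castAdd]
      exact (extendPerm_castAdd (m := m + 1) τ y).symm
    · rw [extendPerm_of_le _ hx]
      exact (extendPerm_of_le (m := m + 1) τ (x := Fin.castAdd 1 x) hx).symm
  · rw [extendPerm_of_le _ hw]
    exact (extendPerm_of_le (m := m + 1) τ (x := w) (by omega)).symm

/-- Symbols may be removed one after another. -/
theorem partialTraceLin_succ (x : SymAlg (n + m + 1)) :
    partialTraceLin n (m + 1) p x = partialTraceLin n m p (partialTraceLin (n + m) 1 p x) := by
  induction x using symAlg_induction with
  | hperm σ =>
    rw [partialTraceLin_perm, map_smul, partialTraceLin_perm, smul_smul, ← pow_add]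
    refine partialTraceLin_perm_of_forall (m := m + 1) p fun τ => ?_
    rw [← extendPerm_extendPerm]
    refine (numOrbits_mul_extendPerm (n := n + m) (m := 1) σ (extendPerm m τ)).trans ?_
    rw [numOrbits_mul_extendPerm, ← add_assoc]
  | hadd x y hx hy =>
    rw [map_add (partialTraceLin (n + m) 1 p), map_add (partialTraceLin n m p), ← hx, ← hy]
    exact map_add _ _ _
  | hsmul c x hx =>
    rw [map_smul (partialTraceLin (n + m) 1 p), map_smul (partialTraceLin n m p), ← hx]
    exact map_smul _ _ _

theorem partialTraceLin_one : partialTraceLin n 1 p 1 = p • 1 := by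
  have h : removeSymbols (n := n) (1 : Equiv.Perm (Fin (n + 1))) = 1 := by
    ext x
    have := castAdd_removeSymbols (m := 1) 1 x
    rw [one_pow, Equiv.Perm.one_apply] at this
    exact congrArg Fin.val (Fin.castAdd_injective n 1 this)
  have h1 := partialTraceLin_perm (n := n) (m := 1) p 1
  rwa [h, numOrbits_one, numOrbits_one, Nat.add_sub_cancel_left, pow_one, map_one perm, map_one perm] at h1

theorem eq_of_sameCycle_swap {a l u v : Fin n} (h : (Equiv.swap a l).SameCycle u v) (hu : u ≠ l)
    (hv : v ≠ l) : u = v := by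
  obtain ⟨k, _, hk⟩ := h.exists_pow_eq'
  have hpow : ∀ k : ℕ, ((Equiv.swap a l) ^ k) u = u ∨ ((Equiv.swap a l) ^ k) u = Equiv.swap a l u := by
    intro k
    induction k with
    | zero => exact Or.inl rfl
    | succ k ih =>
      rw [pow_succ', Equiv.Perm.mul_apply]
      rcases ih with ih | ih <;> simp [ih]
  rcases hpow k with h1 | h1
  · exact h1.symm.trans hk
  · rw [hk] at h1
    by_cases hua : u = a
    · rw [hua, Equiv.swap_apply_left] at h1
      exact absurd h1 hv
    · rw [Equiv.swap_apply_of_ne_of_ne hua hu] at h1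
      exact h1.symm

/-- The removed symbol shares an orbit with a, so no orbit is lost and the power of p is zero. -/
theorem partialTraceLin_transp_last (a : Fin n) :
    partialTraceLin n 1 p (transp (Fin.castAdd 1 a) (Fin.last n)) = 1 := by
  set σ := Equiv.swap (Fin.castAdd 1 a) (Fin.last n) with hσ
  have hne : ∀ x : Fin n, Fin.castAdd 1 x ≠ Fin.last n := fun x => (Fin.castSucc_lt_last x).ne
  have h1 : removeSymbols (n := n) (m := 1) σ = 1 := by
    ext x
    have h2 : (removeSymbols (n := n) (m := 1) σ).SameCycle (removeSymbols (n := n) (m := 1) σ x) x :=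
      Equiv.Perm.sameCycle_apply_left.2 (Equiv.Perm.SameCycle.refl _ _)
    rw [sameCycle_removeSymbols_iff] at h2
    have h3 := eq_of_sameCycle_swap h2 (hne _) (hne _)
    exact congrArg Fin.val (Fin.castAdd_injective n 1 h3)
  have h2 : removedOrbits (n := n) (m := 1) σ = ∅ := by
    rw [Set.eq_empty_iff_forall_notMem]
    rintro _ ⟨⟨y, rfl⟩, hS⟩
    rcases Fin.eq_castSucc_or_eq_last y with ⟨x, rfl⟩ | rfl
    · exact hS x (Equiv.Perm.SameCycle.refl _ _)
    · refine hS a (Equiv.Perm.sameCycle_apply_left.1 ?_)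
      rw [hσ, Equiv.swap_apply_left]
  have h3 := numOrbits_eq_add (n := n) (m := 1) σ
  rw [h2, Set.ncard_empty, add_zero] at h3
  rw [transp_eq_perm, partialTraceLin_perm, h3, Nat.sub_self, pow_zero, one_smul, h1, map_one]

end PartialTrace

/-! ### The fused Yang–Baxter relation -/

section YangBaxter

variable {n : ℕ}

theorem transp_mul_transp_left {a b c : Fin n} (hac : a ≠ c) (hbc : b ≠ c) :
    transp a b * transp a c = transp b c * transp a b := by
  rw [transp_eq_perm a b, perm_mul_transp, Equiv.swap_apply_left,
    Equiv.swap_apply_of_ne_of_ne hac.symm hbc.symm]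

theorem commute_transp {a b c d : Fin n} (hca : c ≠ a) (hcb : c ≠ b) (hda : d ≠ a) (hdb : d ≠ b) :
    Commute (transp a b) (transp c d) :=
  commute_perm_transp (Equiv.swap_apply_of_ne_of_ne hca hcb) (Equiv.swap_apply_of_ne_of_ne hda hdb)

theorem transp_mul_signedSum_of_mem {a b : Fin n} {R : Finset (Fin n)} (hab : a ≠ b) (ha : a ∈ R)
    (hb : b ∈ R) : transp a b * signedSum R = -signedSum R := by
  ext σ
  rw [transp, MonoidAlgebra.coeff_single_mul_apply, one_mul, Equiv.swap_inv, coeff_signedSum,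
    MonoidAlgebra.coeff_neg, Finsupp.neg_apply, coeff_signedSum, Equiv.Perm.sign_mul,
    Equiv.Perm.sign_swap hab]
  have hiff : (∀ x, x ∉ R → (Equiv.swap a b * σ) x = x) ↔ ∀ x, x ∉ R → σ x = x := by
    refine forall₂_congr fun x hx => ?_
    rw [Equiv.Perm.mul_apply, Equiv.swap_apply_eq_iff, Equiv.swap_apply_of_ne_of_ne]
    · rintro rfl; exact hx ha
    · rintro rfl; exact hx hb
  rw [if_congr hiff rfl rfl]
  split_ifs <;> simp

theorem commute_transp_signedSum {a b : Fin n} {R : Finset (Fin n)} (ha : a ∉ R) (hb : b ∉ R) :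
    Commute (transp a b) (signedSum R) := by
  rw [commute_iff_eq, transp_mul_signedSum, map_swap_eq_self (by simp [ha, hb])]

/-- The sum of the transpositions of `a` with the members of `R`. -/
noncomputable def starSum (R : Finset (Fin n)) (a : Fin n) : SymAlg n := ∑ i ∈ R, transp a i

theorem commute_starSum_signedSum {R : Finset (Fin n)} {a : Fin n} (ha : a ∉ R) :
    Commute (starSum R a) (signedSum R) := by
  have := sum_transp_commute_signedSum ha
  rw [Finset.sum_sub_distrib, ← Finset.sum_mul, ← Finset.mul_sum] at this
  exact sub_eq_zero.1 this

/-- Against the antisymmetrizer on R, the star sum S satisfies (S − 1)(S + |R|) = 0: S A_R is the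
difference of the signed sums on R and R ∪ {a}, and S acts on the latter by −|R|. -/
theorem starSum_mul_starSum_mul_signedSum {R : Finset (Fin n)} {a : Fin n} (ha : a ∉ R) :
    starSum R a * (starSum R a * signedSum R) =
      (R.card : ℂ) • signedSum R - ((R.card : ℂ) - 1) • (starSum R a * signedSum R) := by
  have h1 : starSum R a * signedSum R = signedSum R - signedSum (insert a R) := by
    rw [signedSum_insert' ha, starSum, Finset.sum_mul, sub_sub_cancel]
  have h2 : starSum R a * signedSum (insert a R) = -((R.card : ℂ) • signedSum (insert a R)) := by
    rw [starSum, Finset.sum_mul, Finset.sum_congr rfl fun i hi => transp_mul_signedSum_of_mem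
      (ne_of_mem_of_not_mem hi ha).symm (Finset.mem_insert_self a R) (Finset.mem_insert_of_mem hi)]
    rw [Finset.sum_const, ← Nat.cast_smul_eq_nsmul ℂ, smul_neg]
  have h3 : signedSum (insert a R) = signedSum R - starSum R a * signedSum R := by
    rw [h1, sub_sub_cancel]
  conv_lhs => rw [h1, mul_sub, h2, h3]
  module

theorem starSum_mul_transp {R : Finset (Fin n)} {a o : Fin n} (ha : a ∉ R) (ho : o ∉ R) :
    starSum R o * transp a o = transp a o * starSum R a := by
  rw [starSum, starSum, Finset.sum_mul, Finset.mul_sum]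
  refine Finset.sum_congr rfl fun i hi => ?_
  have hai : a ≠ i := fun h => ha (h ▸ hi)
  have hoi : o ≠ i := fun h => ho (h ▸ hi)
  rw [transp_mul_transp_left hai hoi]

theorem transp_mul_starSum {R : Finset (Fin n)} {a o : Fin n} (ha : a ∉ R) (ho : o ∉ R) :
    transp a o * starSum R o = starSum R a * transp a o := by
  rw [starSum, starSum, Finset.sum_mul, Finset.mul_sum]
  refine Finset.sum_congr rfl fun i hi => ?_
  have hai : a ≠ i := fun h => ha (h ▸ hi)
  have hoi : o ≠ i := fun h => ho (h ▸ hi)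
  rw [transp_comm a o, transp_mul_transp_left hoi hai]

/-- Transpositions to different members of R commute, so only the diagonal terms contribute to the
commutator. -/
theorem starSum_mul_starSum {R : Finset (Fin n)} {a o : Fin n} (ha : a ∉ R) (ho : o ∉ R)
    (hao : a ≠ o) :
    starSum R o * starSum R a =
    starSum R a * starSum R o + starSum R a * transp a o - transp a o * starSum R a := by
  have hterm : ∀ i ∈ R, ∀ j ∈ R, transp o i * transp a j = transp a j * transp o i +
      if i = j then transp a i * transp a o - transp a o * transp a i else 0 := by
    intro i hi j hj
    have hai : a ≠ i := fun h => ha (h ▸ hi)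
    have hoi : o ≠ i := fun h => ho (h ▸ hi)
    have haj : a ≠ j := fun h => ha (h ▸ hj)
    have hoj : o ≠ j := fun h => ho (h ▸ hj)
    by_cases hij : i = j
    · subst hij
      rw [if_pos rfl, transp_comm o i, transp_comm a i, transp_mul_transp_left hai.symm hao.symm,
        transp_mul_transp_left hoi.symm hao, transp_comm o a, transp_comm i o]
      have h1 : transp a o * transp o i = transp i a * transp a o := by
        rw [transp_comm a o, transp_mul_transp_left hoi hai, transp_comm a i]
      have h2 : transp a o * transp i a = transp o i * transp a o := by
        rw [transp_comm i a, transp_mul_transp_left hai hoi]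
      rw [h1, h2]
      abel
    · rw [if_neg hij, add_zero]
      exact commute_transp hao hai (Ne.symm hoj) (Ne.symm hij)
  simp only [starSum]
  rw [Finset.sum_mul_sum, Finset.sum_congr rfl fun i hi => Finset.sum_congr rfl fun j hj =>
    hterm i hi j hj]
  simp only [Finset.sum_add_distrib]
  rw [Finset.sum_comm, ← Finset.sum_mul_sum, Finset.sum_congr rfl fun i hi => Finset.sum_ite_eq _ _ _,
    Finset.sum_congr rfl fun i hi => if_pos hi, Finset.sum_sub_distrib, ← Finset.sum_mul,
    ← Finset.mul_sum, add_sub_assoc]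

/-- The fused Yang-Baxter relation. -/
theorem yang_baxter {R : Finset (Fin n)} {a o : Fin n} (ha : a ∉ R) (ho : o ∉ R)
    (hao : a ≠ o) (x y ħ : ℂ) :
    ((x - y + ħ * (R.card - 1)) • (1 : SymAlg n) + ħ • starSum R o) *
      ((x • (1 : SymAlg n) + ħ • transp a o) * ((y • (1 : SymAlg n) + ħ • starSum R a) *
        signedSum R)) =
    (y • (1 : SymAlg n) + ħ • starSum R a) * ((x • (1 : SymAlg n) + ħ • transp a o) *
      (((x - y + ħ * (R.card - 1)) • (1 : SymAlg n) + ħ • starSum R o) * signedSum R)) := by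
  -- Both sides are expanded and reduced by the star-sum relations, multiplied on the right by the
  -- signed sum because the quadratic relation holds only there; what remains is linear in the
  -- surviving words.
  have e6 := starSum_mul_starSum_mul_signedSum ha
  have hσA := (commute_transp_signedSum ha ho).eq
  have e1 := congrArg (· * signedSum R) (starSum_mul_starSum ha ho hao)
  have e2 := congrArg (· * signedSum R) (starSum_mul_transp ha ho)
  have e5 := congrArg (· * signedSum R) (transp_mul_starSum ha ho)
  have e3 := congrArg (· * (starSum R a * signedSum R)) (starSum_mul_transp ha ho)
  have e7 := congrArg (· * transp a o) e6
  simp only [sub_mul, add_mul, smul_mul_assoc, mul_assoc, ← hσA] at e1 e2 e3 e5 e7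
  set A := signedSum R
  set s := starSum R o
  set t := starSum R a
  set σ := transp a o
  simp only [mul_add, add_mul, smul_mul_assoc, mul_smul_comm, one_mul, smul_add, smul_smul]
  simp only [e1, e2, e3, e5, e6, e7, mul_sub, mul_smul_comm, smul_sub, smul_add, smul_smul]
  module

/-- The quadratic relation for the star sum makes the R-matrix invertible on the antisymmetrized
part for generic w. -/
theorem rmatrix_mul_inverse {R : Finset (Fin n)} {o : Fin n} (ho : o ∉ R) (w ħ : ℂ) :
    (w • (1 : SymAlg n) - ħ • starSum R o) *
      (((w + ħ * (R.card - 1)) • (1 : SymAlg n) + ħ • starSum R o) * signedSum R) =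
    ((w + ħ * R.card) * (w - ħ)) • signedSum R := by
  have e6 := starSum_mul_starSum_mul_signedSum ho
  simp only [mul_add, add_mul, sub_mul, smul_mul_assoc, mul_smul_comm, one_mul, smul_smul,
    smul_sub, e6]
  module

end YangBaxter

/-! ### From one site to a product of sites -/

section Products

/-- The train argument: factors at different sites commute, so the products can be interleaved and M
carried past the sites one at a time. -/
theorem rll_prod {α : Type*} [Monoid α] {β : Type*} (L K : β → α) (M A : α) (l : List β)
    (hl : l.Nodup) (hAL : ∀ a ∈ l, Commute A (L a)) (hAK : ∀ a ∈ l, Commute A (K a))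
    (hLK : ∀ a ∈ l, ∀ b ∈ l, a ≠ b → Commute (L a) (K b))
    (h : ∀ a ∈ l, M * (L a * (K a * A)) = K a * (L a * (M * A))) :
    M * ((l.map L).prod * ((l.map K).prod * A)) = (l.map K).prod * ((l.map L).prod * (M * A)) := by
  induction l with
  | nil => simp
  | cons a l ih =>
    simp only [List.forall_mem_cons, List.nodup_cons] at hl hAL hAK h
    have ih := ih hl.2 hAL.2 hAK.2
      (fun b hb c hc => hLK b (List.mem_cons_of_mem _ hb) c (List.mem_cons_of_mem _ hc)) h.2
    simp only [List.map_cons, List.prod_cons]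
    set PL := (l.map L).prod
    set PK := (l.map K).prod
    have c1 : Commute PL (K a) := Commute.list_prod_left _ _ fun x hx => by
      obtain ⟨b, hb, rfl⟩ := List.mem_map.1 hx
      exact hLK b (List.mem_cons_of_mem _ hb) a List.mem_cons_self fun h => hl.1 (h ▸ hb)
    have c2 : Commute (L a) PK := Commute.list_prod_right _ _ fun x hx => by
      obtain ⟨b, hb, rfl⟩ := List.mem_map.1 hx
      exact hLK a List.mem_cons_self b (List.mem_cons_of_mem _ hb) fun h => hl.1 (h ▸ hb)
    have c3 : Commute A PL := Commute.list_prod_right _ _ fun x hx => by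
      obtain ⟨b, hb, rfl⟩ := List.mem_map.1 hx
      exact hAL.2 b hb
    have c4 : Commute A PK := Commute.list_prod_right _ _ fun x hx => by
      obtain ⟨b, hb, rfl⟩ := List.mem_map.1 hx
      exact hAK.2 b hb
    calc M * (L a * PL * (K a * PK * A))
        = M * (L a * ((PL * K a) * (PK * A))) := by simp only [mul_assoc]
      _ = M * (L a * (K a * ((PL * PK) * A))) := by rw [c1.eq]; simp only [mul_assoc]
      _ = (M * (L a * (K a * A))) * (PL * PK) := by
          rw [← (c3.mul_right c4).eq]; simp only [mul_assoc]
      _ = K a * (L a * (M * (A * (PL * PK)))) := by rw [h.1]; simp only [mul_assoc]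
      _ = K a * (L a * (M * (PL * (PK * A)))) := by
          rw [(c3.mul_right c4).eq]; simp only [mul_assoc]
      _ = K a * ((L a * PK) * (PL * (M * A))) := by rw [ih]; simp only [mul_assoc]
      _ = _ := by rw [c2.eq]; simp only [mul_assoc]

end Products

/-! ### Placing two sets of auxiliary symbols side by side -/

section Embeddings

variable {n m k : ℕ}

theorem embed_embed (s : Fin n ↪ Fin m) (r : Fin m ↪ Fin k) (x : SymAlg n) :
    embed r (embed s x) = embed (s.trans r) x := by
  induction x using symAlg_induction with
  | hperm g =>
    rw [embed_perm, embed_perm, embed_perm]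
    congr 1
    ext w
    congr 1
    simp only [Equiv.Perm.viaEmbeddingHom_apply]
    by_cases hw : w ∈ Set.range r
    · obtain ⟨v, rfl⟩ := hw
      rw [Equiv.Perm.viaEmbedding_apply]
      by_cases hv : v ∈ Set.range s
      · obtain ⟨u, rfl⟩ := hv
        rw [Equiv.Perm.viaEmbedding_apply]
        exact (Equiv.Perm.viaEmbedding_apply g (s.trans r) u).symm
      · rw [Equiv.Perm.viaEmbedding_apply_of_notMem _ _ _ hv,
          Equiv.Perm.viaEmbedding_apply_of_notMem]
        rintro ⟨u, hu⟩
        exact hv ⟨u, r.injective hu⟩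
    · rw [Equiv.Perm.viaEmbedding_apply_of_notMem _ _ _ hw,
        Equiv.Perm.viaEmbedding_apply_of_notMem]
      rintro ⟨u, hu⟩
      exact hw ⟨s u, hu⟩
  | hadd x y hx hy => simp only [map_add, hx, hy]
  | hsmul c x hx => simp only [map_smul, hx]

/-- The embedding of `n + 1` symbols into `n + m + 1` symbols whose image
misses the `m` symbols before the last one. -/
def skipEmb (n m : ℕ) : Fin (n + 1) ↪ Fin (n + m + 1) where
  toFun := Fin.lastCases (Fin.last (n + m)) fun x => Fin.castAdd 1 (Fin.castAdd m x)
  inj' x y h := by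
    have hne : ∀ x : Fin (n + m), Fin.castAdd 1 x ≠ Fin.last (n + m) := fun x =>
      (Fin.castSucc_lt_last x).ne
    rcases Fin.eq_castSucc_or_eq_last x with ⟨x, rfl⟩ | rfl <;>
    rcases Fin.eq_castSucc_or_eq_last y with ⟨y, rfl⟩ | rfl
    · simp only [Fin.lastCases_castSucc] at h
      rw [Fin.castAdd_injective _ _ (Fin.castAdd_injective _ _ h)]
    · simp only [Fin.lastCases_castSucc, Fin.lastCases_last] at h
      exact absurd h (hne _)
    · simp only [Fin.lastCases_castSucc, Fin.lastCases_last] at h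
      exact absurd h.symm (hne _)
    · rfl

theorem skipEmb_last : skipEmb n m (Fin.last n) = Fin.last (n + m) := by
  change Fin.lastCases (motive := fun _ => Fin (n + m + 1)) (Fin.last (n + m))
    (fun x : Fin n => Fin.castAdd 1 (Fin.castAdd m x)) (Fin.last n) = _
  rw [Fin.lastCases_last]

theorem skipEmb_castAdd (x : Fin n) :
    skipEmb n m (Fin.castAdd 1 x) = Fin.castAdd 1 (Fin.castAdd m x) := by
  change Fin.lastCases (motive := fun _ => Fin (n + m + 1)) (Fin.last (n + m))
    (fun x : Fin n => Fin.castAdd 1 (Fin.castAdd m x)) (Fin.castSucc x) = _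
  rw [Fin.lastCases_castSucc]

theorem exists_embed_castAddEmb_eq {σ : Equiv.Perm (Fin (n + 1))} (hσ : σ (Fin.last n) = Fin.last n) :
    ∃ τ : Equiv.Perm (Fin n), perm σ = embed (Fin.castAddEmb 1) (perm τ) := by
  obtain ⟨τ, hτ⟩ := exists_viaEmbeddingHom_eq (Fin.castAddEmb 1 : Fin n ↪ Fin (n + 1)) (g := σ)
    fun x hx => by
      rcases Fin.eq_castSucc_or_eq_last x with ⟨y, rfl⟩ | rfl
      · exact absurd ⟨y, rfl⟩ hx
      · exact hσ
  exact ⟨τ, by rw [embed_perm, hτ]⟩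

/-- Removing the last symbol commutes with inserting fixed points. -/
theorem partialTraceLin_embed_skipEmb (p : ℂ) (x : SymAlg (n + 1)) :
    partialTraceLin (n + m) 1 p (embed (skipEmb n m) x) =
      embed (Fin.castAddEmb m) (partialTraceLin n 1 p x) := by
  induction x using symAlg_induction with
  | hperm σ =>
    have hcomp : ∀ y : SymAlg n, embed (skipEmb n m) (embed (Fin.castAddEmb 1) y) =
        embed (Fin.castAddEmb 1) (embed (Fin.castAddEmb m) y) := by
      intro y
      rw [embed_embed, embed_embed]
      congr 2
      ext w : 1
      exact skipEmb_castAdd w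
    -- A permutation either fixes the last symbol or does so after a transposition with it;
    -- linearity over ℂ[𝔖_n] then reduces both traces to those of 1 and of one transposition.
    by_cases hσ : σ (Fin.last n) = Fin.last n
    · obtain ⟨τ, hτ⟩ := exists_embed_castAddEmb_eq hσ
      rw [hτ, hcomp, ← mul_one (embed _ (embed _ _)), partialTraceLin_embed_mul, partialTraceLin_one,
        ← mul_one (embed (Fin.castAddEmb 1) (perm τ)), partialTraceLin_embed_mul, partialTraceLin_one,
        map_mul, map_smul, map_one]
    · obtain ⟨a, ha⟩ : ∃ a : Fin n, Fin.castAdd 1 a = σ⁻¹ (Fin.last n) := by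
        rcases Fin.eq_castSucc_or_eq_last (σ⁻¹ (Fin.last n)) with ⟨y, hy⟩ | hy
        · exact ⟨y, hy.symm⟩
        · refine absurd ?_ hσ
          rw [← hy]
          simpa using hy.symm
      obtain ⟨τ, hτ⟩ := exists_embed_castAddEmb_eq
        (σ := σ * Equiv.swap (Fin.castAdd 1 a) (Fin.last n)) (by simp [ha])
      have hσ' : perm σ = embed (Fin.castAddEmb 1) (perm τ) *
          transp (Fin.castAdd 1 a) (Fin.last n) := by
        rw [← hτ, transp_eq_perm, ← map_mul, mul_assoc, Equiv.swap_mul_self, mul_one]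
      rw [hσ', map_mul, hcomp, embed_transp, skipEmb_castAdd, skipEmb_last, partialTraceLin_embed_mul,
        partialTraceLin_embed_mul, partialTraceLin_transp_last, partialTraceLin_transp_last, mul_one,
        mul_one]
  | hadd x y hx hy => simp only [map_add, hx, hy]
  | hsmul c x hx => simp only [map_smul, hx]

end Embeddings

/-! ### Transfer matrices: commutation and special values -/

section Transfer

variable {n m : ℕ}

/-- The value at `u` of the factor of the monodromy matrix at the site `a`. -/
noncomputable def laxFactor (n m : ℕ) (ħ : ℂ) (z : Fin n → ℂ) (u : ℂ) (a : Fin n) : SymAlg (n + m) :=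
  (u - z a) • (1 : SymAlg (n + m)) + ħ • ∑ i : Fin m, transp (Fin.castAdd m a) (Fin.natAdd n i)

theorem eval_monodromyPoly (ħ : ℂ) (z : Fin n → ℂ) (u : ℂ) :
    (monodromyPoly n m ħ z).eval (algebraMap ℂ (SymAlg (n + m)) u) =
      embed (Fin.natAddEmb n) (antisymmetrizer m) *
        ((List.finRange n).reverse.map (laxFactor n m ħ z u)).prod := by
  let φ : (SymAlg (n + m))[X] →+* SymAlg (n + m) :=
    eval₂RingHom' (RingHom.id _) (algebraMap ℂ (SymAlg (n + m)) u)
      fun a => (Algebra.commutes u a).symm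
  have hφ : ∀ P, φ P = P.eval (algebraMap ℂ (SymAlg (n + m)) u) := fun P => rfl
  rw [monodromyPoly, eval_C_mul, ← hφ, map_list_prod, List.ofFn_eq_map, ← List.map_reverse,
    List.map_map]
  congr 2
  refine List.map_congr_left fun a _ => ?_
  rw [Function.comp_apply, hφ, eval_add, eval_sub, eval_X, eval_C, eval_C, laxFactor, ← map_sub,
    Algebra.algebraMap_eq_smul_one]

/-- The value at `u` of the transfer matrix. -/
noncomputable def transfer (n m : ℕ) (p ħ : ℂ) (z : Fin n → ℂ) (u : ℂ) : SymAlg n :=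
  partialTraceLin n m p ((monodromyPoly n m ħ z).eval (algebraMap ℂ (SymAlg (n + m)) u))

theorem antisymmetrizer_one : antisymmetrizer 1 = 1 := by
  rw [antisymmetrizer, Fintype.sum_unique]
  simp [MonoidAlgebra.one_def]

theorem laxFactor_one (ħ : ℂ) (z : Fin n → ℂ) (u : ℂ) (a : Fin n) : laxFactor n 1 ħ z u a =
    (u - z a) • (1 : SymAlg (n + 1)) + ħ • transp (Fin.castAdd 1 a) (Fin.last n) := by
  rw [laxFactor, Fin.sum_univ_one]
  rfl

theorem transfer_one (p ħ : ℂ) (z : Fin n → ℂ) (u : ℂ) : transfer n 1 p ħ z u =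
    partialTraceLin n 1 p ((List.finRange n).reverse.map (laxFactor n 1 ħ z u)).prod := by
  rw [transfer, eval_monodromyPoly, antisymmetrizer_one, map_one, one_mul]

theorem partialTraceLin_starSum_cyclic (p : ℂ) {R : Finset (Fin (n + m))} {o : Fin (n + m)}
    (hR : ∀ x, Fin.castAdd m x ∉ R) (ho : ∀ x, Fin.castAdd m x ≠ o) (w ħ : ℂ)
    (x : SymAlg (n + m)) :
    partialTraceLin n m p ((w • (1 : SymAlg (n + m)) - ħ • starSum R o) * x) =
      partialTraceLin n m p (x * (w • (1 : SymAlg (n + m)) - ħ • starSum R o)) := by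
  have h1 : ∀ i ∈ R, partialTraceLin n m p (transp o i * x) =
      partialTraceLin n m p (x * transp o i) := fun i hi =>
    partialTraceLin_perm_mul_comm p (fun y => Equiv.swap_apply_of_ne_of_ne (ho y)
      (ne_of_mem_of_not_mem hi (hR y)).symm) x
  have h2 : partialTraceLin n m p (starSum R o * x) = partialTraceLin n m p (x * starSum R o) := by
    rw [starSum, Finset.sum_mul, Finset.mul_sum, map_sum, map_sum, Finset.sum_congr rfl h1]
  simp only [sub_mul, mul_sub, smul_mul_assoc, mul_smul_comm, one_mul, mul_one, map_sub, map_smul, h2]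

/-- Exchange of two monodromy matrices under a functional that is cyclic with respect to the
`R`-matrix. -/
theorem exchange_monodromy {N : ℕ} (Θ : SymAlg N →ₗ[ℂ] SymAlg n) {R : Finset (Fin N)} {o : Fin N}
    (site : Fin n ↪ Fin N) (ho : o ∉ R) (hsite : ∀ a, site a ∉ R) (hso : ∀ a, site a ≠ o)
    (ħ : ℂ) (z : Fin n → ℂ) {u v : ℂ} (h1 : v - u + ħ * R.card ≠ 0) (h2 : v - u - ħ ≠ 0)
    (hcyc : ∀ x, Θ (((v - u) • (1 : SymAlg N) - ħ • starSum R o) * x) =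
      Θ (x * ((v - u) • (1 : SymAlg N) - ħ • starSum R o)))
    {l : List (Fin n)} (hl : l.Nodup) (L K : Fin n → SymAlg N)
    (hL : ∀ a, L a = (v - z a) • (1 : SymAlg N) + ħ • transp (site a) o)
    (hK : ∀ a, K a = (u - z a) • (1 : SymAlg N) + ħ • starSum R (site a)) :
    Θ ((l.map L).prod * (signedSum R * (l.map K).prod)) =
      Θ (signedSum R * (l.map K).prod * (l.map L).prod) := by
  set A := signedSum R with hA
  obtain ⟨M, hM⟩ : ∃ M : SymAlg N, M = (v - u + ħ * (R.card - 1)) • 1 + ħ • starSum R o := ⟨_, rfl⟩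
  obtain ⟨M', hM'⟩ : ∃ M' : SymAlg N, M' = (v - u) • 1 - ħ • starSum R o := ⟨_, rfl⟩
  rw [← hM'] at hcyc
  have cAL : ∀ a, Commute A (L a) := fun a => by
    rw [hL]
    exact ((Commute.one_right A).smul_right _).add_right
      ((commute_transp_signedSum (hsite a) ho).symm.smul_right _)
  have cAK : ∀ a, Commute A (K a) := fun a => by
    rw [hK]
    exact ((Commute.one_right A).smul_right _).add_right
      ((commute_starSum_signedSum (hsite a)).symm.smul_right _)
  have cAs : Commute A (starSum R o) := (commute_starSum_signedSum ho).symm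
  have cAM' : Commute A M' := by
    rw [hM']
    exact ((Commute.one_right A).smul_right _).sub_right (cAs.smul_right _)
  have cMM' : Commute M M' := by
    have h1 : Commute M (starSum R o) := by
      rw [hM]
      exact ((Commute.one_left _).smul_left _).add_left ((Commute.refl _).smul_left _)
    rw [hM']
    exact ((Commute.one_right M).smul_right _).sub_right (h1.smul_right _)
  have cLK : ∀ a b, a ≠ b → Commute (L a) (K b) := by
    intro a b hab
    have h1 : Commute (transp (site a) o) (starSum R (site b)) :=
      Commute.sum_right _ _ _ fun i hi => commute_transp (fun h => hab (site.injective h).symm)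
        (hso b) (ne_of_mem_of_not_mem hi (hsite a)) (ne_of_mem_of_not_mem hi ho)
    have h2 : Commute (transp (site a) o) (K b) := by
      rw [hK]
      exact ((Commute.one_right _).smul_right _).add_right (h1.smul_right _)
    rw [hL]
    exact ((Commute.one_left _).smul_left _).add_left (h2.smul_left _)
  have hrll := rll_prod L K M A l hl (fun a _ => cAL a) (fun a _ => cAK a)
    (fun a _ b _ => cLK a b) fun a _ => by
      have := yang_baxter (hsite a) ho (hso a) (v - z a) (u - z a) ħ
      rw [sub_sub_sub_cancel_right] at this
      rwa [hM, hL, hK]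
  have cPL : Commute A (l.map L).prod := Commute.list_prod_right _ _ fun x hx => by
    obtain ⟨b, _, rfl⟩ := List.mem_map.1 hx
    exact cAL b
  have cPK : Commute A (l.map K).prod := Commute.list_prod_right _ _ fun x hx => by
    obtain ⟨b, _, rfl⟩ := List.mem_map.1 hx
    exact cAK b
  set PL := (l.map L).prod
  set PK := (l.map K).prod
  set q : ℂ := (v - u + ħ * R.card) * (v - u - ħ) with hq
  have hMM' : M' * (M * A) = q • A := by
    rw [hM, hM']
    exact rmatrix_mul_inverse ho (v - u) ħ
  have hq0 : q ≠ 0 := mul_ne_zero h1 h2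
  -- Insert M'M, a nonzero scalar against A; carry M through the products, move M' to the other end
  -- by cyclicity, and cancel.
  have e1 : q • (PL * (PK * A)) = M' * (M * (PL * (PK * A))) := by
    have : PL * (PK * A) = A * (PL * PK) := by rw [(cPL.mul_right cPK).eq, mul_assoc]
    rw [this, ← smul_mul_assoc, ← hMM']
    simp only [mul_assoc]
  have e2 : PK * (PL * (M * A)) * M' = q • (PK * (PL * A)) := by
    have h3 : M * A * M' = M' * (M * A) := by
      rw [mul_assoc, cAM'.eq, ← mul_assoc, cMM'.eq, mul_assoc]
    rw [mul_assoc, mul_assoc PL, h3, hMM', mul_smul_comm, mul_smul_comm]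
  have e3 : q • Θ (PL * (PK * A)) = q • Θ (PK * (PL * A)) := by
    rw [← map_smul, ← map_smul, e1, hrll, hcyc, e2]
  rw [cPK.eq, smul_right_injective _ hq0 e3, ← cPL.eq, mul_assoc]

/-- The monodromy of T_m uses m auxiliary symbols and that of T_1 one further symbol, the last.
Tracing out the last symbol first factors the trace of their product, in either order, into the
product of the transfer matrices. The two inequalities make the R-matrix invertible. -/
theorem commute_transfer (p ħ : ℂ) (z : Fin n → ℂ) {u v : ℂ} (h1 : v - u + ħ * m ≠ 0)
    (h2 : v - u - ħ ≠ 0) : Commute (transfer n 1 p ħ z v) (transfer n m p ħ z u) := by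
  set r : Fin m ↪ Fin (n + m + 1) := (Fin.natAddEmb n).trans (Fin.castAddEmb 1) with hr
  set R := Finset.univ.map r with hR
  obtain ⟨site, hsite⟩ : ∃ site : Fin n ↪ Fin (n + m + 1),
      ∀ a, site a = Fin.castAdd 1 (Fin.castAdd m a) :=
    ⟨(Fin.castAddEmb m).trans (Fin.castAddEmb 1), fun _ => rfl⟩
  have hcard : R.card = m := by simp [hR]
  have hval : ∀ i, ((r i : Fin (n + m + 1)) : ℕ) = n + i := fun i => rfl
  have ho : Fin.last (n + m) ∉ R := by
    rw [hR, Finset.mem_map]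
    rintro ⟨i, _, hi⟩
    have h3 := congrArg Fin.val hi
    have h5 := i.2
    rw [hval, Fin.val_last] at h3
    omega
  have hsR : ∀ a, site a ∉ R := by
    intro a
    rw [hR, Finset.mem_map]
    rintro ⟨i, _, hi⟩
    have h3 := congrArg Fin.val hi
    have h5 := a.2
    rw [hval, hsite, Fin.val_castAdd, Fin.val_castAdd] at h3
    omega
  have hso : ∀ a, site a ≠ Fin.last (n + m) := by
    intro a ha
    rw [hsite] at ha
    exact (Fin.castSucc_lt_last _).ne ha
  have hcyc := partialTraceLin_starSum_cyclic (n := n) (m := m + 1) p (R := R)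
    (o := Fin.last (n + m)) (fun x => hsite x ▸ hsR x) (fun x => hsite x ▸ hso x) (v - u) ħ
  have hex := exchange_monodromy (partialTraceLin n (m + 1) p) site ho hsR hso ħ z (by rwa [hcard]) h2 hcyc
    (List.nodup_reverse.2 (List.nodup_finRange n))
    (fun a => embed (skipEmb n m) (laxFactor n 1 ħ z v a))
    (fun a => embed (Fin.castAddEmb 1) (laxFactor n m ħ z u a))
    (fun a => by
      rw [laxFactor_one, map_add, map_smul, map_smul, map_one, embed_transp, skipEmb_castAdd,
        skipEmb_last, hsite])
    (fun a => by
      rw [laxFactor, map_add, map_smul, map_smul, map_one, map_sum, starSum, hR, Finset.sum_map]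
      simp only [embed_transp, hsite]
      rfl)
  set tL := ((List.finRange n).reverse.map (laxFactor n 1 ħ z v)).prod with htL
  set tK := ((List.finRange n).reverse.map (laxFactor n m ħ z u)).prod with htK
  set A₀ := embed (Fin.natAddEmb n) (antisymmetrizer m) with hA₀
  have hA : signedSum R = (m.factorial : ℂ) • embed (Fin.castAddEmb 1) A₀ := by
    rw [hR, ← embed_antisymmetrizer, hA₀, embed_embed]
  have hL : ((List.finRange n).reverse.map fun a => embed (skipEmb n m) (laxFactor n 1 ħ z v a)).prod =
      embed (skipEmb n m) tL := by
    rw [htL, map_list_prod, List.map_map]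
    rfl
  have hK : ((List.finRange n).reverse.map fun a =>
      embed (Fin.castAddEmb 1) (laxFactor n m ħ z u a)).prod = embed (Fin.castAddEmb 1) tK := by
    rw [htK, map_list_prod, List.map_map]
    rfl
  rw [hL, hK, hA, smul_mul_assoc, ← map_mul, mul_smul_comm, smul_mul_assoc] at hex
  have hex' : (m.factorial : ℂ) • partialTraceLin n (m + 1) p
      (embed (skipEmb n m) tL * embed (Fin.castAddEmb 1) (A₀ * tK)) =
      (m.factorial : ℂ) • partialTraceLin n (m + 1) p
      (embed (Fin.castAddEmb 1) (A₀ * tK) * embed (skipEmb n m) tL) :=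
    (map_smul (partialTraceLin n (m + 1) p) _ _).symm.trans (hex.trans
      (map_smul (partialTraceLin n (m + 1) p) _ _))
  have hex'' := smul_right_injective _ (Nat.cast_ne_zero.2 m.factorial_ne_zero : (m.factorial : ℂ) ≠ 0)
    hex'
  rw [partialTraceLin_succ (m := m), partialTraceLin_succ (m := m), partialTraceLin_mul_embed,
    partialTraceLin_embed_mul, partialTraceLin_embed_skipEmb, partialTraceLin_embed_mul,
    partialTraceLin_mul_embed] at hex''
  rw [commute_iff_eq, transfer_one, transfer, eval_monodromyPoly]
  exact hex''

theorem commute_transfer_of_mem_betheXXX {p ħ : ℂ} (z : Fin n → ℂ) (v : ℂ)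
    {y : SymAlg n} (hy : y ∈ betheXXX n p ħ z) : Commute y (transfer n 1 p ħ z v) := by
  set H := transfer n 1 p ħ z v with hH
  induction hy using Algebra.adjoin_induction with
  | mem y h =>
    obtain ⟨m, i, _, _, _, _, rfl⟩ := h
    -- The R-matrix degenerates for at most two values of u; the remaining values still determine
    -- the coefficients.
    refine sub_eq_zero.1 (map_coeff_eq_zero ((LinearMap.mulRight ℂ H - LinearMap.mulLeft ℂ H) ∘ₗ
      partialTraceLin n m p) (S := {v + ħ * m, v - ħ}ᶜ) (Set.Finite.infinite_compl (by simp))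
      (fun u hu => ?_) _)
    simp only [Set.mem_compl_iff, Set.mem_insert_iff, Set.mem_singleton_iff, not_or] at hu
    refine sub_eq_zero.2 (commute_transfer p ħ z ?_ ?_).eq.symm
    · intro h
      exact hu.1 (by linear_combination -h)
    · intro h
      exact hu.2 (by linear_combination -h)
  | algebraMap r => exact Algebra.commutes r H
  | add a b _ _ ha hb => exact ha.add_left hb
  | mul a b _ _ ha hb => exact ha.mul_left hb

theorem monic_prod_and_natDegree {S : Type*} [Ring S] [Nontrivial S] (l : List S) :
    (l.map fun c => X + C c).prod.Monic ∧ (l.map fun c => X + C c).prod.natDegree = l.length := by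
  induction l with
  | nil => exact ⟨monic_one, natDegree_one⟩
  | cons c l ih =>
    rw [List.map_cons, List.prod_cons, List.length_cons]
    refine ⟨(monic_X_add_C c).mul ih.1, ?_⟩
    rw [(monic_X_add_C c).natDegree_mul ih.1, ih.2, natDegree_X_add_C, add_comm]

/-- The generators omit the leading coefficient, but the monodromy polynomial is monic, so that
coefficient is the trace of 1, the scalar p. -/
theorem transfer_one_mem_betheXXX (p ħ : ℂ) (z : Fin n → ℂ) (hn : 2 ≤ n) (v : ℂ) :
    transfer n 1 p ħ z v ∈ betheXXX n p ħ z := by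
  set P := monodromyPoly n 1 ħ z with hP
  obtain ⟨c, hc, hPc⟩ : ∃ c : List (SymAlg (n + 1)), c.length = n ∧
      P = (c.map fun c => X + C c).prod := by
    refine ⟨(List.finRange n).reverse.map fun a => ħ • ∑ i : Fin 1, transp (Fin.castAdd 1 a)
      (Fin.natAdd n i) - algebraMap ℂ (SymAlg (n + 1)) (z a), by simp, ?_⟩
    rw [hP, monodromyPoly, antisymmetrizer_one, map_one, C_1, one_mul, List.ofFn_eq_map,
      ← List.map_reverse, List.map_map]
    congr 1
    refine List.map_congr_left fun a _ => ?_
    rw [Function.comp_apply, C_sub]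
    abel
  obtain ⟨hmonic, hdeg⟩ := hPc ▸ monic_prod_and_natDegree c
  rw [hc] at hdeg
  have hcoeff : P.coeff n = 1 := (congrArg P.coeff hdeg).symm.trans hmonic
  rw [transfer, ← hP, eval_algebraMap_eq_sum, map_sum, hdeg]
  refine sum_mem fun k hk => ?_
  rw [map_smul]
  refine Subalgebra.smul_mem _ ?_ _
  rcases (Nat.lt_succ_iff.1 (Finset.mem_range.1 hk)).lt_or_eq with h | rfl
  · refine Algebra.subset_adjoin ⟨1, n - k, le_rfl, by omega, by omega, by omega, ?_⟩
    change _ = partialTrace p (P.coeff (n - (n - k)))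
    rw [Nat.sub_sub_self h.le]
    rfl
  · rw [hcoeff, partialTraceLin_one]
    exact Subalgebra.smul_mem _ (one_mem _) _

/-- At `u = z a` the first transfer matrix becomes a product in the group algebra. -/
theorem transfer_one_apply_site (p ħ : ℂ) (z : Fin n → ℂ) (a : Fin n) {l₁ l₂ : List (Fin n)}
    (hl : (List.finRange n).reverse = l₁ ++ a :: l₂) :
    transfer n 1 p ħ z (z a) =
      ħ • ((l₂ ++ l₁).map fun b => (z a - z b) • (1 : SymAlg n) + ħ • transp a b).prod := by
  have hnd : (l₁ ++ a :: l₂).Nodup := hl ▸ List.nodup_reverse.2 (List.nodup_finRange n)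
  rw [List.nodup_append, List.nodup_cons] at hnd
  obtain ⟨-, ⟨ha2, -⟩, hdisj⟩ := hnd
  have ha1 : a ∉ l₁ := fun h => hdisj a h a List.mem_cons_self rfl
  set o := Fin.last n with ho
  have hne : ∀ b : Fin n, Fin.castAdd 1 b ≠ o := fun b => (Fin.castSucc_lt_last b).ne
  set F := laxFactor n 1 ħ z (z a) with hF
  set f : Fin n → SymAlg n := fun b => (z a - z b) • (1 : SymAlg n) + ħ • transp a b with hf
  set ε := embed (Fin.castAddEmb 1 : Fin n ↪ Fin (n + 1)) with hε
  set σ := transp (Fin.castAdd 1 a) o with hσ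
  have hFa : F a = ħ • σ := by rw [hF, laxFactor_one, sub_self, zero_smul, zero_add]
  have hεf : ∀ b, ε (f b) = (z a - z b) • (1 : SymAlg (n + 1)) +
      ħ • transp (Fin.castAdd 1 a) (Fin.castAdd 1 b) := by
    intro b
    rw [hε, hf]
    simp only [map_add, map_smul, map_one, embed_transp]
    rfl
  have hFσ : ∀ b, b ≠ a → F b * σ = σ * ε (f b) := by
    intro b hb
    have hba : Fin.castAdd 1 b ≠ Fin.castAdd 1 a := fun h => hb (Fin.castAdd_injective _ _ h)
    rw [hF, laxFactor_one, hεf, add_mul, mul_add, smul_mul_assoc, mul_smul_comm, one_mul, mul_one,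
      smul_mul_assoc, mul_smul_comm, hσ, transp_eq_perm _ o, perm_mul_transp, Equiv.swap_apply_left,
      Equiv.swap_apply_of_ne_of_ne hba (hne b), transp_comm o]
  have hσF : ∀ b, b ≠ a → σ * F b = ε (f b) * σ := by
    intro b hb
    have hba : Fin.castAdd 1 b ≠ Fin.castAdd 1 a := fun h => hb (Fin.castAdd_injective _ _ h)
    rw [hF, laxFactor_one, hεf, add_mul, mul_add, smul_mul_assoc, mul_smul_comm, one_mul, mul_one,
      smul_mul_assoc, mul_smul_comm, hσ, transp_eq_perm _ o, perm_mul_transp, Equiv.swap_apply_right,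
      Equiv.swap_apply_of_ne_of_ne hba (hne b), transp_comm (Fin.castAdd 1 b)]
  have hFf : ∀ b ∈ l₁, ∀ c ∈ l₂, Commute (F b) (ε (f c)) := by
    intro b hb c hc
    have hbc : c ≠ b := (hdisj b hb c (List.mem_cons_of_mem _ hc)).symm
    have hba : a ≠ b := fun h => ha1 (h ▸ hb)
    have h1 : Commute (transp (Fin.castAdd 1 b) o) (transp (Fin.castAdd 1 a) (Fin.castAdd 1 c)) :=
      commute_transp (fun h => hba (Fin.castAdd_injective _ _ h)) (hne a)
        (fun h => hbc (Fin.castAdd_injective _ _ h)) (hne c)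
    rw [hF, laxFactor_one, hεf]
    refine ((Commute.one_left _).smul_left _).add_left (Commute.smul_left ?_ _)
    exact ((Commute.one_right _).smul_right _).add_right (h1.smul_right _)
  -- The factor at a is ħ times the transposition σ of a with the auxiliary symbol. Moving σ
  -- leftwards past l₁ or rightwards past l₂ turns auxiliary factors into factors in ℂ[𝔖_n], leaving
  -- a single σ, of trace 1.
  have p1 : (l₁.map F).prod * σ = σ * ε (l₁.map f).prod := by
    clear hl hdisj hFf
    induction l₁ with
    | nil => simp
    | cons b l ih =>
      rw [List.mem_cons, not_or] at ha1
      rw [List.map_cons, List.prod_cons, List.map_cons, List.prod_cons, map_mul, mul_assoc,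
        ih ha1.2, ← mul_assoc, hFσ b (Ne.symm ha1.1), mul_assoc]
  have p2 : σ * (l₂.map F).prod = ε (l₂.map f).prod * σ := by
    clear hl hdisj hFf
    induction l₂ with
    | nil => simp
    | cons b l ih =>
      rw [List.mem_cons, not_or] at ha2
      rw [List.map_cons, List.prod_cons, List.map_cons, List.prod_cons, map_mul, ← mul_assoc,
        hσF b (Ne.symm ha2.1), mul_assoc, ih ha2.2, mul_assoc]
  have p3 : Commute (l₁.map F).prod (ε (l₂.map f).prod) := by
    rw [map_list_prod, List.map_map]
    refine Commute.list_prod_left _ _ fun x hx => Commute.list_prod_right _ _ fun y hy => ?_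
    obtain ⟨b, hb, rfl⟩ := List.mem_map.1 hx
    obtain ⟨c, hc, rfl⟩ := List.mem_map.1 hy
    exact hFf b hb c hc
  rw [transfer_one, ← hF, hl, List.map_append, List.prod_append, List.map_cons, List.prod_cons, hFa,
    smul_mul_assoc, mul_smul_comm, p2, ← mul_assoc, p3.eq, mul_assoc, p1, map_smul,
    partialTraceLin_embed_mul, partialTraceLin_mul_embed, partialTraceLin_transp_last, one_mul,
    List.map_append, List.prod_append]

end Transfer

/-! ### Consequences of rapidly growing gaps -/

section Asymptotics

variable {ι : Type*} {l : Filter ι} {n : ℕ} {w : ι → ℕ → ℂ}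

/-- Ratios of consecutive gaps telescope. The cancelled gaps have positive index, so the first gap,
which may vanish, is never divided by. -/
theorem tendsto_sub_div_of_lt (hne : ∀ k, k + 2 < n → ∀ᶠ t in l, w t (k + 1) - w t (k + 2) ≠ 0)
    (hlim : ∀ k, k + 2 < n →
      Tendsto (fun t => (w t k - w t (k + 1)) / (w t (k + 1) - w t (k + 2))) l (𝓝 0))
    {b a e : ℕ} (hba : b < a) (hae : a ≤ e) (he : e + 1 < n) :
    Tendsto (fun t => (w t a - w t b) / (w t e - w t (e + 1))) l (𝓝 0) := by
  induction e generalizing a with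
  | zero => omega
  | succ e ih =>
    have key : ∀ a, b < a → a ≤ e →
        Tendsto (fun t => (w t a - w t b) / (w t (e + 1) - w t (e + 1 + 1))) l (𝓝 0) := by
      intro a hba hae
      have h1 := (ih hba hae (by omega)).mul (hlim e he)
      rw [mul_zero] at h1
      obtain ⟨e, rfl⟩ : ∃ e', e = e' + 1 := ⟨e - 1, by omega⟩
      refine h1.congr' ((hne e (by omega)).mono fun t ht => ?_)
      rw [div_mul_div_cancel₀ ht]
    rcases hae.lt_or_eq with h | rfl
    · exact key a hba (by omega)
    · have h1 := (hlim e he).neg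
      rcases (Nat.lt_succ_iff.1 hba).lt_or_eq with h | rfl
      · have h2 := h1.add (key e h le_rfl)
        rw [neg_zero, add_zero] at h2
        refine h2.congr fun t => ?_
        rw [← neg_div, ← add_div]
        congr 1
        ring
      · rw [neg_zero] at h1
        refine h1.congr fun t => ?_
        rw [← neg_div, neg_sub]

/-- The last gap dominates the difference; `1 ≤ e` keeps the possibly zero first gap out of the
denominator. -/
theorem tendsto_sub_div_of_le (hne : ∀ k, k + 2 < n → ∀ᶠ t in l, w t (k + 1) - w t (k + 2) ≠ 0)
    (hlim : ∀ k, k + 2 < n →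
      Tendsto (fun t => (w t k - w t (k + 1)) / (w t (k + 1) - w t (k + 2))) l (𝓝 0))
    {a e : ℕ} (hae : a ≤ e) (he0 : 1 ≤ e) (he : e + 1 < n) :
    Tendsto (fun t => (w t (e + 1) - w t a) / (w t e - w t (e + 1))) l (𝓝 (-1)) := by
  have h1 : Tendsto (fun t => (w t e - w t a) / (w t e - w t (e + 1))) l (𝓝 0) := by
    rcases hae.lt_or_eq with h | rfl
    · exact tendsto_sub_div_of_lt hne hlim h le_rfl he
    · simpa using tendsto_const_nhds
  have h2 := h1.const_add (-1)
  rw [add_zero] at h2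
  obtain ⟨e, rfl⟩ : ∃ e', e = e' + 1 := ⟨e - 1, by omega⟩
  refine h2.congr' ((hne e he).mono fun t ht => ?_)
  field_simp
  ring

/-- For b below e the difference z_{e+1} − z_b is dominated by its last gap, the numerator up to
sign; for b above e + 1 it is dominated by a later, much larger gap. -/
theorem tendsto_div_sub_of_ne (hne : ∀ k, k + 2 < n → ∀ᶠ t in l, w t (k + 1) - w t (k + 2) ≠ 0)
    (hlim : ∀ k, k + 2 < n →
      Tendsto (fun t => (w t k - w t (k + 1)) / (w t (k + 1) - w t (k + 2))) l (𝓝 0))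
    {e b : ℕ} (he : e + 1 < n) (hb : b < n) (hbe : b ≠ e) (hbe' : b ≠ e + 1) :
    (∀ᶠ t in l, w t (e + 1) - w t b ≠ 0) ∧
      Tendsto (fun t => (w t (e + 1) - w t e) / (w t (e + 1) - w t b)) l
        (𝓝 (if b < e + 1 then 1 else 0)) := by
  rcases lt_or_gt_of_ne hbe' with h | h
  · have h1 := tendsto_sub_div_of_le hne hlim (show b ≤ e by omega) (by omega) he
    refine ⟨?_, ?_⟩
    · refine (h1.eventually_ne (by norm_num : (-1 : ℂ) ≠ 0)).mono fun t ht h => ht ?_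
      rw [h, zero_div]
    · have h2 := (h1.inv₀ (by norm_num)).neg
      rw [if_pos h]
      norm_num at h2
      refine h2.congr fun t => ?_
      rw [← neg_div, neg_sub]
  · obtain ⟨f, rfl⟩ : ∃ f, b = f + 2 := ⟨b - 2, by omega⟩
    have h1 := tendsto_sub_div_of_le hne hlim (show e + 1 ≤ f + 1 by omega) (by omega) hb
    refine ⟨?_, ?_⟩
    · refine (h1.eventually_ne (by norm_num : (-1 : ℂ) ≠ 0)).mono fun t ht h => ht ?_
      rw [← neg_sub, h, neg_zero, zero_div]
    · have h2 := ((tendsto_sub_div_of_lt hne hlim (Nat.lt_succ_self e)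
        (show e + 1 ≤ f + 1 by omega) hb).div h1 (by norm_num)).neg
      rw [if_neg (by omega)]
      norm_num at h2
      refine h2.congr' ((hne f hb).mono fun t ht => ?_)
      rw [div_div_div_cancel_right₀ ht, ← div_neg, neg_sub]

theorem tendsto_div_sub_succ {ħ : ι → ℂ}
    (hne : ∀ k, k + 2 < n → ∀ᶠ t in l, w t (k + 1) - w t (k + 2) ≠ 0)
    (hlim : ∀ k, k + 2 < n →
      Tendsto (fun t => (w t k - w t (k + 1)) / (w t (k + 1) - w t (k + 2))) l (𝓝 0))
    (h01 : ∀ᶠ t in l, w t 0 - w t 1 ≠ 0) (hħ : Tendsto (fun t => ħ t / (w t 0 - w t 1)) l (𝓝 0))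
    {e : ℕ} (he : e + 1 < n) :
    (∀ᶠ t in l, w t e - w t (e + 1) ≠ 0) ∧
      Tendsto (fun t => ħ t / (w t e - w t (e + 1))) l (𝓝 0) := by
  induction e with
  | zero => exact ⟨h01, hħ⟩
  | succ e ih =>
    obtain ⟨h1, h2⟩ := ih (by omega)
    refine ⟨hne e he, ?_⟩
    have h3 := h2.mul (hlim e he)
    rw [mul_zero] at h3
    exact h3.congr' (h1.mono fun t ht => div_mul_div_cancel₀ ht)

/-- The first order term of a product of factors close to the identity. -/
theorem coeffTendsto_prod_sub_one {β : Type*} {ε : ι → ℂ} {κ : ι → β → ℂ} {κ₀ : β → ℂ}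
    (s : β → SymAlg n) (hε : Tendsto ε l (𝓝 0)) (hε0 : ∀ᶠ t in l, ε t ≠ 0) (L : List β)
    (hκ : ∀ b ∈ L, Tendsto (fun t => κ t b) l (𝓝 (κ₀ b))) :
    CoeffTendsto (fun t => (ε t)⁻¹ • ((L.map fun b => 1 + (ε t * κ t b) • s b).prod - 1)) l
      (L.map fun b => κ₀ b • s b).sum := by
  induction L with
  | nil => simpa using CoeffTendsto.const (l := l) (0 : SymAlg n)
  | cons b L ih =>
    rw [List.forall_mem_cons] at hκ
    have ih := ih hκ.2
    set P : ι → SymAlg n := fun t => (L.map fun b => 1 + (ε t * κ t b) • s b).prod with hP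
    have hP1 : CoeffTendsto P l 1 := by
      have h1 := (CoeffTendsto.const (l := l) (1 : SymAlg n)).add (CoeffTendsto.smul hε ih)
      rw [zero_smul, add_zero] at h1
      refine h1.congr' (hε0.mono fun t ht => ?_)
      rw [smul_smul, mul_inv_cancel₀ ht, one_smul, add_sub_cancel]
    have h2 := (CoeffTendsto.smul hκ.1 ((CoeffTendsto.const (l := l) (s b)).mul hP1)).add ih
    rw [mul_one] at h2
    rw [List.map_cons, List.sum_cons]
    refine h2.congr' (hε0.mono fun t ht => ?_)
    rw [List.map_cons, List.prod_cons]
    change _ = (ε t)⁻¹ • ((1 + (ε t * κ t b) • s b) * P t - 1)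
    rw [add_mul, one_mul, smul_mul_assoc, add_sub_right_comm, smul_add, smul_smul, ← mul_assoc,
      inv_mul_cancel₀ ht, one_mul, add_comm]

end Asymptotics

/-! ### The two limits -/

section Limits

variable {n : ℕ}

theorem jucysMurphy_eq_sum (a : Fin n) :
    jucysMurphy a = ∑ b with b ≠ a, (if (b : ℕ) < a then (1 : ℂ) else 0) • transp a b := by
  rw [jucysMurphy, Finset.sum_filter, Finset.sum_filter]
  refine Finset.sum_congr rfl fun b _ => ?_
  rcases lt_trichotomy b a with h | h | h
  · rw [if_pos h, if_pos h.ne, if_pos (Fin.lt_def.1 h), one_smul, transp_comm]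
  · rw [if_neg h.not_lt, if_neg (not_not.2 h)]
  · rw [if_neg h.not_gt, if_pos h.ne', if_neg (Fin.lt_def.not.1 h.not_gt), zero_smul]

theorem jucysMurphy_eq_zero {a : Fin n} (ha : (a : ℕ) = 0) : jucysMurphy a = 0 := by
  rw [jucysMurphy, Finset.sum_eq_zero]
  intro b hb
  have : (b : ℕ) < a := (Finset.mem_filter.1 hb).2
  omega

variable {ι : Type*} {l : Filter ι} {z : ι → Fin n → ℂ}
  {B : ι → Subalgebra ℂ (SymAlg n)}

/-- It suffices to approximate each Jucys-Murphy element by elements of the subalgebras that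
commute with these subalgebras. -/
theorem subalgebraTendsto_gelfandZetlin (h : ∀ a : Fin n, (a : ℕ) ≠ 0 → ∃ x : ι → SymAlg n,
      CoeffTendsto x l (jucysMurphy a) ∧ ∀ᶠ t in l, x t ∈ B t ∧ ∀ y ∈ B t, Commute y (x t)) :
    SubalgebraTendsto B l (gelfandZetlin n) := by
  have h' : ∀ a : Fin n, ∃ x : ι → SymAlg n,
      CoeffTendsto x l (jucysMurphy a) ∧ ∀ᶠ t in l, x t ∈ B t ∧ ∀ y ∈ B t, Commute y (x t) := by
    intro a
    by_cases ha : (a : ℕ) = 0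
    · rw [jucysMurphy_eq_zero ha]
      exact ⟨fun _ => 0, CoeffTendsto.const _, Eventually.of_forall fun t =>
        ⟨zero_mem _, fun y _ => Commute.zero_right y⟩⟩
    · exact h a ha
  choose x hx hxB using h'
  rw [gelfandZetlin_eq]
  refine subalgebraTendsto_of_generators (x := fun t a => x a t) (x₀ := jucysMurphy) hx ?_ ?_ le_rfl
    fun y hy => mem_jucysMurphyAlg_of_commute hy
  · exact eventually_all.2 fun a => (hxB a).mono fun t ht => ht.1
  · exact (eventually_all.2 hxB).mono fun t ht y hy a => (ht a).2 y hy

variable {w : ι → ℕ → ℂ}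

theorem betheGaudin_tendsto
    (hne : ∀ k, k + 2 < n → ∀ᶠ t in l, w t (k + 1) - w t (k + 2) ≠ 0)
    (hlim : ∀ k, k + 2 < n →
      Tendsto (fun t => (w t k - w t (k + 1)) / (w t (k + 1) - w t (k + 2))) l (𝓝 0))
    (hw : ∀ t (b : Fin n), w t b = z t b) :
    SubalgebraTendsto (fun t => betheGaudin n (z t)) l (gelfandZetlin n) := by
  refine subalgebraTendsto_gelfandZetlin fun a ha => ?_
  obtain ⟨a, han⟩ := a
  obtain ⟨e, rfl⟩ : ∃ e, a = e + 1 := ⟨a - 1, by simp at ha; omega⟩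
  set a : Fin n := ⟨e + 1, han⟩ with hadef
  set a' : Fin n := ⟨e, by omega⟩ with ha'def
  have haa' : a' ≠ a := by simp [hadef, ha'def]
  have hw' : ∀ t k (hk : k < n), w t k = z t ⟨k, hk⟩ := fun t k hk => hw t ⟨k, hk⟩
  have hz : ∀ b : Fin n, b ≠ a' → b ≠ a → (∀ᶠ t in l, z t a - z t b ≠ 0) ∧
      Tendsto (fun t => (z t a - z t a') / (z t a - z t b)) l
        (𝓝 (if (b : ℕ) < a then 1 else 0)) := by
    intro b hb' hb
    have h1 := tendsto_div_sub_of_ne hne hlim han b.2 (fun h => hb' (Fin.ext h))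
      (fun h => hb (Fin.ext h))
    simpa only [hw, hw' _ (e + 1) han, hw' _ e (by omega : e < n)] using h1
  -- The value 1 at a' is imposed because z_a = z_{a'} may occur when a' is the first site, where
  -- the quotient would be 0/0.
  let κ : ι → Fin n → ℂ := fun t b => if b = a' then 1 else (z t a - z t a') / (z t a - z t b)
  refine ⟨fun t => ∑ b with b ≠ a, κ t b • transp a b, ?_, ?_⟩
  · rw [jucysMurphy_eq_sum]
    refine CoeffTendsto.sum _ fun b hb => CoeffTendsto.smul ?_ (CoeffTendsto.const _)
    have hb : b ≠ a := (Finset.mem_filter.1 hb).2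
    by_cases hb' : b = a'
    · subst hb'
      rw [if_pos (show e < e + 1 by omega)]
      simp only [κ, if_true]
      exact tendsto_const_nhds
    · simp only [κ, if_neg hb']
      exact (hz b hb' hb).2
  · have hev : ∀ᶠ t in l, ∀ b : Fin n, b ≠ a' → b ≠ a → z t a - z t b ≠ 0 :=
      eventually_all.2 fun b => eventually_imp_distrib_left.2 fun hb' =>
        eventually_imp_distrib_left.2 fun hb => (hz b hb' hb).1
    refine hev.mono fun t ht => ?_
    have hκ : ∀ b, b ≠ a → κ t b * (z t a - z t b) = z t a - z t a' := by
      intro b hb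
      by_cases hb' : b = a'
      · subst hb'
        simp only [κ, if_true, one_mul]
      · simp only [κ, if_neg hb']
        exact div_mul_cancel₀ _ (ht b hb' hb)
    exact ⟨hamiltonian_mem_betheGaudin (z t) haa' (fun b hb hb' => sub_ne_zero.1 (ht b hb' hb)) (κ t)
      (if_pos rfl) hκ, fun y hy => commute_hamiltonian_of_mem_betheGaudin (z t) a (κ t) _ hκ hy⟩

theorem betheXXX_tendsto
    (hne : ∀ k, k + 2 < n → ∀ᶠ t in l, w t (k + 1) - w t (k + 2) ≠ 0)
    (hlim : ∀ k, k + 2 < n →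
      Tendsto (fun t => (w t k - w t (k + 1)) / (w t (k + 1) - w t (k + 2))) l (𝓝 0))
    (hw : ∀ t (b : Fin n), w t b = z t b)
    (p ħ : ι → ℂ) (hħ0 : ∀ᶠ t in l, ħ t ≠ 0)
    (hħ : 2 ≤ n → (∀ᶠ t in l, w t 0 - w t 1 ≠ 0) ∧
        Tendsto (fun t => ħ t / (w t 0 - w t 1)) l (𝓝 0)) :
    SubalgebraTendsto (fun t => betheXXX n (p t) (ħ t) (z t)) l (gelfandZetlin n) := by
  refine subalgebraTendsto_gelfandZetlin fun a ha => ?_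
  obtain ⟨a, han⟩ := a
  obtain ⟨e, rfl⟩ : ∃ e, a = e + 1 := ⟨a - 1, by simp at ha; omega⟩
  have hn : 2 ≤ n := by omega
  obtain ⟨h01, hħ⟩ := hħ hn
  set a : Fin n := ⟨e + 1, han⟩ with hadef
  set a' : Fin n := ⟨e, by omega⟩ with ha'def
  have hw' : ∀ t k (hk : k < n), w t k = z t ⟨k, hk⟩ := fun t k hk => hw t ⟨k, hk⟩
  have hħ' := tendsto_div_sub_succ (ħ := ħ) hne hlim h01 hħ han
  simp only [hw' _ (e + 1) han, hw' _ e (by omega : e < n)] at hħ'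
  have hδ : ∀ᶠ t in l, z t a - z t a' ≠ 0 := hħ'.1.mono fun t ht h => ht (by rw [← neg_sub, h, neg_zero])
  have hε : Tendsto (fun t => ħ t / (z t a - z t a')) l (𝓝 0) := by
    have := hħ'.2.neg
    rw [neg_zero] at this
    refine this.congr fun t => ?_
    rw [← div_neg, neg_sub]
  have hz : ∀ b : Fin n, b ≠ a → (∀ᶠ t in l, z t a - z t b ≠ 0) ∧
      Tendsto (fun t => (z t a - z t a') / (z t a - z t b)) l
        (𝓝 (if (b : ℕ) < a then 1 else 0)) := by
    intro b hb
    by_cases hb' : b = a'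
    · rw [hb', if_pos (show e < e + 1 by omega)]
      exact ⟨hδ, tendsto_const_nhds.congr' (hδ.mono fun t ht => (div_self ht).symm)⟩
    have h1 := tendsto_div_sub_of_ne hne hlim han b.2 (fun h => hb' (Fin.ext h))
      (fun h => hb (Fin.ext h))
    simpa only [hw, hw' _ (e + 1) han, hw' _ e (by omega : e < n)] using h1
  obtain ⟨l₁, l₂, hl⟩ := List.append_of_mem (List.mem_reverse.2 (List.mem_finRange a))
  have hnd : (l₁ ++ a :: l₂).Nodup := hl ▸ List.nodup_reverse.2 (List.nodup_finRange n)
  have hperm : (a :: (l₂ ++ l₁)).Perm (l₁ ++ a :: l₂) := by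
    simpa using (List.perm_append_comm (l₁ := a :: l₂) (l₂ := l₁))
  obtain ⟨haL, hL⟩ := List.nodup_cons.1 (hperm.nodup_iff.2 hnd)
  set L := l₂ ++ l₁ with hLdef
  have hmemL : ∀ b, b ∈ L ↔ b ≠ a := by
    intro b
    refine ⟨fun h hb => haL (hb ▸ h), fun hb => ?_⟩
    have h1 : b ∈ a :: L := hperm.mem_iff.2 (hl ▸ List.mem_reverse.2 (List.mem_finRange b))
    exact (List.mem_cons.1 h1).resolve_left hb
  let κ : ι → Fin n → ℂ := fun t b => (z t a - z t a') / (z t a - z t b)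
  -- With this ε the factor at b is z_a − z_b times 1 + ε κ_b σ_{a,b}, where κ_b is the Gaudin
  -- coefficient; hence the first-order term is the Gaudin Hamiltonian.
  let ε : ι → ℂ := fun t => ħ t / (z t a - z t a')
  have hε0 : ∀ᶠ t in l, ε t ≠ 0 := (hħ0.and hδ).mono fun t ht => div_ne_zero ht.1 ht.2
  refine ⟨fun t => (ε t)⁻¹ • ((L.map fun b => 1 + (ε t * κ t b) • transp a b).prod - 1), ?_, ?_⟩
  · have h1 := coeffTendsto_prod_sub_one (κ₀ := fun b : Fin n => if (b : ℕ) < a then (1 : ℂ) else 0)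
      (fun b => transp a b) hε hε0 L (κ := κ) fun b hb => (hz b ((hmemL b).1 hb)).2
    have hLs : L.toFinset = Finset.univ.filter fun b => b ≠ a := by
      ext b
      simp [hmemL]
    rwa [← List.sum_toFinset _ hL, hLs, ← jucysMurphy_eq_sum] at h1
  · have hev : ∀ᶠ t in l, ∀ b : Fin n, b ≠ a → z t a - z t b ≠ 0 :=
      eventually_all.2 fun b => eventually_imp_distrib_left.2 fun hb => (hz b hb).1
    refine ((hev.and hħ0).and hδ).mono ?_
    rintro t ⟨⟨ht, htħ⟩, htδ⟩
    set c := (L.map fun b => z t a - z t b).prod with hc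
    have hc0 : c ≠ 0 := by
      refine List.prod_ne_zero fun h0 => ?_
      obtain ⟨b, hb, h⟩ := List.mem_map.1 h0
      exact ht b ((hmemL b).1 hb) h
    have hT := transfer_one_apply_site (p t) (ħ t) (z t) a hl
    have hscale : ∀ L' : List (Fin n), (∀ b ∈ L', b ≠ a) →
        (L'.map fun b => (z t a - z t b) • (1 : SymAlg n) + ħ t • transp a b).prod =
        (L'.map fun b => z t a - z t b).prod •
          (L'.map fun b => 1 + (ε t * κ t b) • transp a b).prod := by
      intro L' hL'
      induction L' with
      | nil => simp
      | cons b L' ih =>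
        rw [List.forall_mem_cons] at hL'
        simp only [List.map_cons, List.prod_cons]
        have h1 : (z t a - z t b) • (1 : SymAlg n) + ħ t • transp a b =
            (z t a - z t b) • (1 + (ε t * κ t b) • transp a b) := by
          rw [smul_add, smul_smul]
          congr 2
          have := ht b hL'.1
          simp only [ε, κ]
          field_simp
        rw [ih hL'.2, h1, smul_mul_smul_comm]
    rw [hscale L fun b => (hmemL b).1, ← hc] at hT
    have hP : (L.map fun b => 1 + (ε t * κ t b) • transp a b).prod =
        (ħ t * c)⁻¹ • transfer n 1 (p t) (ħ t) (z t) (z t a) := by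
      rw [hT, smul_smul, smul_smul, mul_assoc, inv_mul_cancel₀ (mul_ne_zero htħ hc0), one_smul]
    beta_reduce
    rw [hP]
    refine ⟨Subalgebra.smul_mem _ (sub_mem (Subalgebra.smul_mem _
      (transfer_one_mem_betheXXX _ _ _ hn _) _) (one_mem _)) _, fun y hy => ?_⟩
    exact (((commute_transfer_of_mem_betheXXX (z t) (z t a) hy).smul_right _).sub_right
      (Commute.one_right y)).smul_right _

end Limits

end BetheSym

theorem proposition2p4 (n : ℕ) {ι : Type*} (l : Filter ι) (z : ι → Fin n → ℂ)
    (hne : ∀ (k : ℕ) (hk : k + 2 < n), ∀ᶠ t in l,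
      z t ⟨k + 1, by omega⟩ - z t ⟨k + 2, hk⟩ ≠ 0)
    (hlim : ∀ (k : ℕ) (hk : k + 2 < n),
      Tendsto (fun t => (z t ⟨k, by omega⟩ - z t ⟨k + 1, by omega⟩) /
        (z t ⟨k + 1, by omega⟩ - z t ⟨k + 2, hk⟩)) l (𝓝 0)) :
    BetheSym.SubalgebraTendsto (fun t => BetheSym.betheGaudin n (z t)) l
      (BetheSym.gelfandZetlin n) ∧
    ∀ p ħ : ι → ℂ, (∀ᶠ t in l, ħ t ≠ 0) →
      (∀ hn : 2 ≤ n,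
        (∀ᶠ t in l, z t ⟨0, by omega⟩ - z t ⟨1, by omega⟩ ≠ 0) ∧
        Tendsto (fun t => ħ t / (z t ⟨0, by omega⟩ - z t ⟨1, by omega⟩)) l (𝓝 0)) →
      BetheSym.SubalgebraTendsto (fun t => BetheSym.betheXXX n (p t) (ħ t) (z t)) l
        (BetheSym.gelfandZetlin n) := by
  -- Extending z by 0 to all natural indices avoids carrying bounds through the asymptotics; only
  -- indices below n are used.
  let w : ι → ℕ → ℂ := fun t k => if hk : k < n then z t ⟨k, hk⟩ else 0
  have hw : ∀ t (b : Fin n), w t b = z t b := fun t b => dif_pos b.2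
  have hw' : ∀ t k (hk : k < n), w t k = z t ⟨k, hk⟩ := fun t k hk => dif_pos hk
  have hne' : ∀ k, k + 2 < n → ∀ᶠ t in l, w t (k + 1) - w t (k + 2) ≠ 0 := fun k hk => by
    simpa only [hw' _ (k + 1) (by omega), hw' _ (k + 2) hk] using hne k hk
  have hlim' : ∀ k, k + 2 < n →
      Tendsto (fun t => (w t k - w t (k + 1)) / (w t (k + 1) - w t (k + 2))) l (𝓝 0) := fun k hk => by
    simpa only [hw' _ k (by omega), hw' _ (k + 1) (by omega), hw' _ (k + 2) hk] using hlim k hk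
  refine ⟨BetheSym.betheGaudin_tendsto hne' hlim' hw, fun p ħ hħ0 hħ =>
    BetheSym.betheXXX_tendsto hne' hlim' hw p ħ hħ0 fun hn => ?_⟩
  simpa only [hw' _ 0 (by omega : 0 < n), hw' _ 1 (by omega : 1 < n)] using hħ hn
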